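/- Let $\ell$ be an odd integer with $\ell \not\equiv \pm 2 \pmod 5$ such that every prime divisor $p$ of $\ell$ satisfies $p \equiv 1 \pmod 4$, and put $k = -(1+16\ell^2)$. Let $\mathcal{U}_k$ be the affine scheme over $\mathbb{Z}$ defined by $$x^2+y^2+z^2-4x^2y^2z^2 = k,$$ and let $U_k$ be its generic fibre over $\mathbb{Q}$. Put $\mathcal{U}_k(\mathbf{A}_{\mathbb{Z}}) = \mathcal{U}_k(\mathbb{R}) \times \prod_p \mathcal{U}_k(\mathbb{Z}_p)$. Let $\mathrm{Br}_1\,U_k$ be the kernel of $\mathrm{Br}\,U_k \to \mathrm{Br}\,(U_k \times_{\mathbb{Q}} \overline{\mathbb{Q}})$ and $\mathrm{Br}_0\,U_k$ the image of $\mathrm{Br}\,\mathbb{Q} \to \mathrm{Br}\,U_k$. Write $(f,g)$ for the class of the quaternion algebra with $i^2=f$, $j^2=g$, $ij=-ji$ over the function field $\mathbb{Q}(U_k)$, and regard $\mathrm{Br}\,U_k$ as a subgroup of $\mathrm{Br}\,\mathbb{Q}(U_k)$. Then there is a class $\mathcal{A} \in \mathrm{Br}_1\,U_k$, represented by an Azumaya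 algebra of rank $4$ over the coordinate ring of $U_k$, with $$\mathcal{A} = (4x^2y^2-1,\,k+1) = (4y^2z^2-1,\,k+1) = (4z^2x^2-1,\,k+1)$$ (hence also in $\mathrm{Br}_1\,U_k/\mathrm{Br}_0\,U_k$), and $\mathcal{A}$ gives an algebraic Brauer--Manin obstruction to the integral Hasse principle on $\mathcal{U}_k$: we have $\mathcal{U}_k(\mathbf{A}_{\mathbb{Z}}) \neq \emptyset$, but $$\mathcal{U}_k(\mathbb{Z}) \subset \mathcal{U}_k(\mathbf{A}_{\mathbb{Z}})^{\mathcal{A}} = \emptyset,$$ where $\mathcal{U}_k(\mathbf{A}_{\mathbb{Z}})^{\mathcal{A}}$ is the set of $(P_v)_v \in \mathcal{U}_k(\mathbf{A}_{\mathbb{Z}})$ with $\sum_v \mathrm{inv}_v\,\mathcal{A}(P_v) = 0$ in $\mathbb{Q}/\mathbb{Z}$. More precisely, $\mathrm{inv}_2\,\mathcal{A}(P) = \tfrac12$ for every $P \in \mathcal{U}_k(\mathbb{Z}_2)$, while $\mathrm{inv}_p\,\mathcal{A}(P) = 0$ for every odd prime $p$ and every $P \in \mathcal{U}_k(\mathbb{Z}_p)$,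 and $\mathrm{inv}_\infty\,\mathcal{A}(P) = 0$ for every $P \in \mathcal{U}_k(\mathbb{R})$. -/

import Mathlib

open scoped TensorProduct

noncomputable section

namespace MarkoffK3

/-! ### Azumaya algebras and Brauer classes over a commutative ring -/

/-- An `R`-algebra `A` is split if it is isomorphic to `End_R(P)` for a finitely generated projective
faithful `R`-module `P`.  The Brauer class of an Azumaya algebra is trivial exactly when the algebra
is split.  Over a field, this says that `A` is a matrix algebra. -/
def IsSplit (R : Type) [CommRing R] (A : Type) [Ring A] [Algebra R A] : Prop :=
  ∃ (P : Type) (_ : AddCommGroup P) (_ : Module R P),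
    Module.Finite R P ∧ Module.Projective R P ∧ FaithfulSMul R P ∧
      Nonempty (A ≃ₐ[R] Module.End R P)

/-- Brauer equivalence of `R`-algebras: `A ⊗ End(P) ≃ B ⊗ End(Q)` for some finitely generated
projective faithful `R`-modules `P` and `Q`.  Two Azumaya algebras are equivalent if and only if they
have the same class in the Brauer group of `R`. -/
def BrauerEquivalent (R : Type) [CommRing R] (A : Type) [Ring A] [Algebra R A]
    (B : Type) [Ring B] [Algebra R B] : Prop :=
  ∃ (P : Type) (_ : AddCommGroup P) (_ : Module R P)
    (Q : Type) (_ : AddCommGroup Q) (_ : Module R Q),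
    (Module.Finite R P ∧ Module.Projective R P ∧ FaithfulSMul R P) ∧
    (Module.Finite R Q ∧ Module.Projective R Q ∧ FaithfulSMul R Q) ∧
      Nonempty ((A ⊗[R] Module.End R P) ≃ₐ[R] (B ⊗[R] Module.End R Q))

/-- A quaternion Azumaya algebra over `R`: an Azumaya `R`-algebra of constant rank `4`.  Its fibre at
a point with values in a field `K` is a quaternion algebra (a four-dimensional central simple algebra)
over `K`. -/
structure QuaternionAzumaya (R : Type) [CommRing R] where
  carrier : Type
  [ring : Ring carrier]
  [algebra : Algebra R carrier]
  [isAzumaya : IsAzumaya R carrier]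
  rank_eq_four : ∀ 𝔭 : PrimeSpectrum R, Module.rankAtStalk (R := R) carrier 𝔭 = 4

attribute [instance] QuaternionAzumaya.ring QuaternionAzumaya.algebra QuaternionAzumaya.isAzumaya

/-- The base change `S ⊗_R A` of a quaternion Azumaya algebra to an `R`-algebra `S` splits over `S`. -/
def QuaternionAzumaya.SplitsOver {R : Type} [CommRing R] (𝒜 : QuaternionAzumaya R)
    (S : Type) [CommRing S] [Algebra R S] : Prop :=
  IsSplit S (S ⊗[R] 𝒜.carrier)

/-! ### The surface -/

/-- The polynomial `x² + y² + z² - 4x²y²z² - k` over `ℚ`. -/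
def surfacePoly (k : ℤ) : MvPolynomial (Fin 3) ℚ :=
  MvPolynomial.X 0 ^ 2 + MvPolynomial.X 1 ^ 2 + MvPolynomial.X 2 ^ 2
    - 4 * MvPolynomial.X 0 ^ 2 * MvPolynomial.X 1 ^ 2 * MvPolynomial.X 2 ^ 2
    - MvPolynomial.C (k : ℚ)

/-- The coordinate ring `ℚ[U_k]` of the affine surface `U_k`. -/
abbrev CoordRing (k : ℤ) : Type :=
  MvPolynomial (Fin 3) ℚ ⧸ Ideal.span {surfacePoly k}

/-- The coordinate functions `x, y, z` (for `i = 0, 1, 2`) on `U_k`. -/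
def coord (k : ℤ) (i : Fin 3) : CoordRing k :=
  Ideal.Quotient.mk (Ideal.span {surfacePoly k}) (MvPolynomial.X i)

/-- The function field `ℚ(U_k)`. -/
abbrev FunField (k : ℤ) : Type := FractionRing (CoordRing k)

/-- The `S`-points `𝒰_k(S)` of the integral model `x² + y² + z² - 4x²y²z² = k` over `ℤ`. -/
@[ext]
structure Point (k : ℤ) (S : Type) [CommRing S] where
  x : S
  y : S
  z : S
  eqn : x ^ 2 + y ^ 2 + z ^ 2 - 4 * x ^ 2 * y ^ 2 * z ^ 2 = (k : S)

/-- The map `𝒰_k(S) → 𝒰_k(T)` induced by a ring homomorphism `S → T`. -/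
def Point.map {k : ℤ} {S T : Type} [CommRing S] [CommRing T] (φ : S →+* T) (P : Point k S) :
    Point k T where
  x := φ P.x
  y := φ P.y
  z := φ P.z
  eqn := by
    have h := congrArg φ P.eqn
    simpa only [map_sub, map_add, map_mul, map_pow, map_ofNat, map_intCast] using h

/-- A point with values in a `ℚ`-algebra `K`, as the homomorphism `ℚ[U_k] → K` of evaluation. -/
def Point.evalHom {k : ℤ} {K : Type} [CommRing K] [Algebra ℚ K] (P : Point k K) :
    CoordRing k →ₐ[ℚ] K :=
  Ideal.Quotient.liftₐ (Ideal.span {surfacePoly k}) (MvPolynomial.aeval ![P.x, P.y, P.z]) (by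
    intro a ha
    obtain ⟨b, rfl⟩ := Ideal.mem_span_singleton'.1 ha
    have h : MvPolynomial.aeval ![P.x, P.y, P.z] (surfacePoly k) = 0 := by
      have h := P.eqn
      simp [surfacePoly, h]
    rw [map_mul, h, mul_zero])

/-! ### Brauer classes on the surface -/

/-- The class of `𝒜` in `Br U_k` lies in `Br₁ U_k`, the kernel of `Br U_k → Br (U_k × ℚ̄)`. -/
def IsAlgebraicClass {k : ℤ} (𝒜 : QuaternionAzumaya (CoordRing k)) : Prop :=
  𝒜.SplitsOver (CoordRing k ⊗[ℚ] AlgebraicClosure ℚ)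

/-- The image of the class of `𝒜` under `Br U_k ⊆ Br ℚ(U_k)` is the class `(f, g)` of the quaternion
algebra over the function field `ℚ(U_k)` with `i² = f`, `j² = g`, `ij = -ji`. -/
def HasGenericClass {k : ℤ} (𝒜 : QuaternionAzumaya (CoordRing k)) (f g : CoordRing k) : Prop :=
  BrauerEquivalent (FunField k) (FunField k ⊗[CoordRing k] 𝒜.carrier)
    (QuaternionAlgebra (FunField k) (algebraMap (CoordRing k) (FunField k) f) 0
      (algebraMap (CoordRing k) (FunField k) g))

/-- The fibre `𝒜(P)` of `𝒜` at `P ∈ U_k(K)` splits over `K`. -/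
def IsSplitAt {k : ℤ} (𝒜 : QuaternionAzumaya (CoordRing k)) {K : Type} [CommRing K] [Algebra ℚ K]
    (P : Point k K) : Prop :=
  letI : Algebra (CoordRing k) K := P.evalHom.toRingHom.toAlgebra
  𝒜.SplitsOver K

/-- The group `ℚ/ℤ`. -/
abbrev QmodZ : Type := AddCircle (1 : ℚ)

open Classical in
/-- The local invariant `inv_K 𝒜(P) ∈ ℚ/ℤ` at `P ∈ U_k(K)`, for `K = ℝ` or `K = ℚ_p`.  Since `𝒜(P)`
is a quaternion algebra over `K`, it is `0` if `𝒜(P)` splits and `1/2` if it is a division algebra. -/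
def localInv {k : ℤ} (𝒜 : QuaternionAzumaya (CoordRing k)) {K : Type} [Field K] [Algebra ℚ K]
    (P : Point k K) : QmodZ :=
  if IsSplitAt 𝒜 P then 0 else ((1 / 2 : ℚ) : QmodZ)

/-! ### Integral adelic points and the Brauer-Manin set -/

instance (p : Nat.Primes) : Fact (p : ℕ).Prime := ⟨p.2⟩

/-- The set `𝒰_k(𝐀_ℤ) = 𝒰_k(ℝ) × ∏_p 𝒰_k(ℤ_p)`. -/
abbrev AdelicPoint (k : ℤ) : Type :=
  Point k ℝ × (∀ p : Nat.Primes, Point k ℤ_[(p : ℕ)])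

/-- The diagonal map `𝒰_k(ℤ) → 𝒰_k(𝐀_ℤ)`. -/
def diagonal {k : ℤ} (P : Point k ℤ) : AdelicPoint k :=
  (P.map (Int.castRingHom ℝ), fun p => P.map (Int.castRingHom ℤ_[(p : ℕ)]))

/-- The invariant at infinity of `𝒜` at a real point. -/
def invInfty {k : ℤ} (𝒜 : QuaternionAzumaya (CoordRing k)) (P : Point k ℝ) : QmodZ :=
  localInv 𝒜 P

/-- The invariant at `p` of `𝒜` at a point of `𝒰_k(ℤ_p) ⊆ U_k(ℚ_p)`. -/
def invAt {k : ℤ} (𝒜 : QuaternionAzumaya (CoordRing k)) (p : Nat.Primes)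
    (P : Point k ℤ_[(p : ℕ)]) : QmodZ :=
  localInv 𝒜 (P.map (PadicInt.Coe.ringHom (p := (p : ℕ))))

/-- The Brauer-Manin set `𝒰_k(𝐀_ℤ)^𝒜`: the integral adelic points whose local invariants sum to zero
over all places. -/
def brauerManinSet {k : ℤ} (𝒜 : QuaternionAzumaya (CoordRing k)) : Set (AdelicPoint k) :=
  {P | invInfty 𝒜 P.1 + ∑ᶠ p : Nat.Primes, invAt 𝒜 p (P.2 p) = 0}

end MarkoffK3

end

open MarkoffK3

/-! Since k + 1 = -(4ℓ)², the class in question is (f, -1) with f = 4x²y² - 1. The equation of the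
surface gives (4x²y² - 1)(4x²z² - 1) = (2x² + 1)² + (8ℓx)², and the same with x and y exchanged. A
product that is a sum of two squares is a norm from the extension by √-1, so the three symbols
agree. On f = 0 the identity makes -1 a square, so (f, -1) has no residue there and extends over
U_k. The extension is an explicit order in the generic quaternion algebra (`NormForm.order`). A pair
of dual bases for its trace form (`TraceFrame`) yields the Azumaya property and rank 4, and is
inherited by every fibre. Adjoining √-1 splits the algebra, so the class is algebraic.

Local invariants are read off from f(P). Over ℝ, f ≤ 0 would force k ≥ 0, so f is a positive square.
If p ≡ 1 mod 4, -1 is a square. If p ≡ 3 mod 4 and p divided f, then 2xy = ±1 mod p and (x ± y)² = k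
+ 1 = -(4ℓ)², impossible because p does not divide ℓ; so f is a unit, hence a sum of two squares
(`Point.xy_ne_zero`, `PadicInt.exists_sq_add_sq`). At 2, f ≡ 3 mod 4 and the norm form of (-1, f) is
anisotropic (`Padic.two_anisotropic`). The invariants therefore always sum to 1/2.

The inclusion of the integral points needs no reciprocity law: there are none, because a positive f
≡ 3 mod 4 has a prime factor p ≡ 3 mod 4 (`isEmpty_point_int`). -/

/-! ### Azumaya and split algebras from a trace form and its Casimir element. -/

/-- An algebra with a reduced trace whose trace form has a pair of dual bases, the Casimir element of
which represents the trace, and for which `a ↦ tr a - a` is an anti-automorphism. -/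
structure TraceFrame (ι R A : Type*) [Fintype ι] [CommRing R] [Ring A] [Algebra R A] where
  tr : A →ₗ[R] R
  u : ι → A
  v : ι → A
  tr_one : tr 1 = 2
  sum_left : ∀ a, ∑ i, tr (a * u i) • v i = a
  sum_right : ∀ a, ∑ i, tr (v i * a) • u i = a
  casimir : ∀ a, ∑ i, u i * a * v i = tr a • (1 : A)
  conj_mul : ∀ a b, tr (a * b) • (1 : A) - a * b = (tr b • (1 : A) - b) * (tr a • (1 : A) - a)

namespace TraceFrame

variable {ι R A : Type*} [Fintype ι] [CommRing R] [Ring A] [Algebra R A]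

theorem finite (F : TraceFrame ι R A) : Module.Finite R A := by
  classical
  refine ⟨⟨Finset.univ.image F.v, ?_⟩⟩
  rw [eq_top_iff]
  intro a _
  rw [← F.sum_left a]
  exact Submodule.sum_mem _ fun i _ => Submodule.smul_mem _ _ (Submodule.subset_span (by simp))

theorem projective (F : TraceFrame ι R A) : Module.Projective R A := by
  let f : A →ₗ[R] (ι → R) := LinearMap.pi fun i => F.tr ∘ₗ LinearMap.mulRight R (F.u i)
  let g : (ι → R) →ₗ[R] A := Fintype.linearCombination R F.v
  refine Module.Projective.of_split f g (LinearMap.ext fun a => ?_)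
  simpa [f, g, Fintype.linearCombination_apply] using F.sum_left a

theorem faithfulSMul (F : TraceFrame ι R A) (h2 : IsUnit (2 : R)) : FaithfulSMul R A := by
  refine ⟨fun {r s} h => ?_⟩
  have := congrArg F.tr (h 1)
  rw [map_smul, map_smul, F.tr_one, smul_eq_mul, smul_eq_mul] at this
  exact h2.mul_right_cancel this

theorem isAzumaya (F : TraceFrame ι R A) (h2 : IsUnit (2 : R)) : IsAzumaya R A := by
  have := F.finite
  have := F.projective
  have := F.faithfulSMul h2
  refine { bij := ?_ }
  -- The inverse of A ⊗ Aᵒᵖ → End A is T ↦ ∑ T(uᵢ) uⱼ vᵢ ⊗ vⱼ. In either composite one of the two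
  -- sums collapses by `casimir`, the other by a dual basis relation.
  let g : Module.End R A →ₗ[R] A ⊗[R] Aᵐᵒᵖ :=
    ∑ i, ∑ j, (TensorProduct.mk R A Aᵐᵒᵖ).flip (MulOpposite.op (F.v j)) ∘ₗ
      LinearMap.mulRight R (F.u j * F.v i) ∘ₗ LinearMap.applyₗ (F.u i)
  have hg : ∀ T, g T = ∑ i, ∑ j, (T (F.u i) * (F.u j * F.v i)) ⊗ₜ MulOpposite.op (F.v j) := by
    intro T
    simp [g, mul_assoc]
  refine Function.bijective_iff_has_inverse.2 ⟨g, fun t => ?_, fun T => LinearMap.ext fun x => ?_⟩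
  · induction t using TensorProduct.induction_on with
    | zero => rw [map_zero, map_zero]
    | add s t hs ht => rw [map_add, map_add, hs, ht]
    | tmul a b =>
      rw [hg, Finset.sum_comm]
      have h (j : ι) : ∑ i, AlgHom.mulLeftRight R A (a ⊗ₜ b) (F.u i) * (F.u j * F.v i)
          = F.tr (b.unop * F.u j) • a := by
        rw [← mul_one a, ← mul_smul_comm, mul_one, ← F.casimir, Finset.mul_sum]
        simp [mul_assoc]
      simp_rw [← TensorProduct.sum_tmul, h, TensorProduct.smul_tmul, ← TensorProduct.tmul_sum,
        ← MulOpposite.op_smul]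
      rw [← Finset.op_sum, F.sum_left, MulOpposite.op_unop]
  · rw [hg]
    simp only [map_sum, LinearMap.sum_apply, AlgHom.mulLeftRight_apply, MulOpposite.unop_op]
    have h (i : ι) : ∑ j, T (F.u i) * (F.u j * F.v i) * x * F.v j
        = F.tr (F.v i * x) • T (F.u i) := by
      rw [← mul_one (T (F.u i)), ← mul_smul_comm, mul_one, ← F.casimir, Finset.mul_sum]
      simp [mul_assoc]
    simp_rw [h, ← map_smul, ← map_sum, F.sum_right]

/-- Multiply `conj_mul b e` on the left by e: its right side begins with e(1 - e) = 0. -/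
theorem mul_mul_eq (F : TraceFrame ι R A) {e : A} (he : e * e = e) (hte : F.tr e = 1) (b : A) :
    e * b * e = F.tr (b * e) • e := by
  have h := congrArg (e * ·) (F.conj_mul b e)
  simp only [hte, one_smul, mul_sub, ← mul_assoc, sub_mul, he, mul_one, mul_smul_comm] at h
  rw [sub_self, smul_zero, zero_sub, sub_self, neg_zero, sub_eq_zero] at h
  exact h.symm

theorem tr_mul_comm (F : TraceFrame ι R A) (a b : A) : F.tr (a * b) = F.tr (b * a) := by
  have h := congrArg F.tr (F.conj_mul a b)
  simp only [map_sub, map_smul, sub_mul, mul_sub, smul_mul_assoc, mul_smul_comm, one_mul, mul_one,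
    F.tr_one, smul_eq_mul] at h
  linear_combination h

theorem smul_smul_one_tmul {S : Type*} [CommRing S] [Algebra R S] (r : R) (s : S) (a : A) :
    (r • s) • ((1 : S) ⊗ₜ[R] a) = s ⊗ₜ[R] (r • a) := by
  rw [TensorProduct.smul_tmul', smul_eq_mul, mul_one, TensorProduct.smul_tmul]

/-- Base change of a trace frame. -/
noncomputable def baseChange (F : TraceFrame ι R A) (S : Type*) [CommRing S] [Algebra R S] :
    TraceFrame ι S (S ⊗[R] A) where
  tr := (TensorProduct.AlgebraTensorModule.rid R S S).toLinearMap ∘ₗ F.tr.baseChange S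
  u i := 1 ⊗ₜ F.u i
  v i := 1 ⊗ₜ F.v i
  tr_one := by
    simp [Algebra.TensorProduct.one_def, F.tr_one, ← Algebra.algebraMap_eq_smul_one, map_ofNat]
  sum_left a := by
    induction a using TensorProduct.induction_on with
    | zero => simp
    | add s t hs ht =>
      simp only [add_mul, map_add, add_smul, Finset.sum_add_distrib]
      rw [hs, ht]
    | tmul s a =>
      simp only [Algebra.TensorProduct.tmul_mul_tmul, mul_one, LinearMap.comp_apply,
        LinearMap.baseChange_tmul, LinearEquiv.coe_coe, smul_smul_one_tmul,
        TensorProduct.AlgebraTensorModule.rid_tmul, ← TensorProduct.tmul_sum, F.sum_left]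
  sum_right a := by
    induction a using TensorProduct.induction_on with
    | zero => simp
    | add s t hs ht =>
      simp only [mul_add, map_add, add_smul, Finset.sum_add_distrib]
      rw [hs, ht]
    | tmul s a =>
      simp only [Algebra.TensorProduct.tmul_mul_tmul, one_mul, LinearMap.comp_apply,
        LinearMap.baseChange_tmul, LinearEquiv.coe_coe, smul_smul_one_tmul,
        TensorProduct.AlgebraTensorModule.rid_tmul, ← TensorProduct.tmul_sum, F.sum_right]
  casimir a := by
    induction a using TensorProduct.induction_on with
    | zero => simp
    | add s t hs ht =>
      simp only [mul_add, add_mul, map_add, add_smul, Finset.sum_add_distrib]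
      rw [hs, ht]
    | tmul s a =>
      simp only [Algebra.TensorProduct.one_def, Algebra.TensorProduct.tmul_mul_tmul, one_mul,
        mul_one, ← TensorProduct.tmul_sum, F.casimir, LinearMap.comp_apply,
        LinearMap.baseChange_tmul, LinearEquiv.coe_coe,
        TensorProduct.AlgebraTensorModule.rid_tmul, smul_smul_one_tmul]
  conj_mul a b := by
    induction a using TensorProduct.induction_on with
    | zero => simp
    | add s t hs ht =>
      simp only [add_mul, map_add, add_smul, mul_sub, mul_add] at hs ht ⊢
      linear_combination (norm := abel) hs + ht
    | tmul s a =>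
      induction b using TensorProduct.induction_on with
      | zero => simp
      | add t t' hs ht =>
        simp only [add_mul, map_add, add_smul, sub_mul, mul_add] at hs ht ⊢
        linear_combination (norm := abel) hs + ht
      | tmul t b =>
        simp only [Algebra.TensorProduct.one_def, Algebra.TensorProduct.tmul_mul_tmul,
          LinearMap.comp_apply, LinearMap.baseChange_tmul, LinearEquiv.coe_coe,
          TensorProduct.AlgebraTensorModule.rid_tmul, smul_smul_one_tmul,
          ← TensorProduct.tmul_sub, F.conj_mul, mul_comm t s]

@[simp]
theorem baseChange_tr_tmul (F : TraceFrame ι R A) (S : Type*) [CommRing S] [Algebra R S] (s : S) (a : A) :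
    (F.baseChange S).tr (s ⊗ₜ a) = F.tr a • s := by
  simp [baseChange]

/-- The rank is the trace of the identity, which is ∑ tr(vᵢ uᵢ) by the dual bases and tr(tr(1) · 1)
= 4 by Casimir. Characteristic zero turns this equality in the local ring into one of natural
numbers. -/
theorem rankAtStalk_eq_four (F : TraceFrame ι R A) [Algebra ℚ R] (𝔭 : PrimeSpectrum R) :
    Module.rankAtStalk (R := R) A 𝔭 = 4 := by
  have := F.finite
  have := F.projective
  let S := Localization.AtPrime 𝔭.asIdeal
  let G := F.baseChange S
  have := G.finite
  have := G.projective
  have : Module.Free S (S ⊗[R] A) := Module.free_of_flat_of_isLocalRing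
  rw [Module.rankAtStalk_eq_finrank_tensorProduct]
  have h1 : LinearMap.trace S (S ⊗[R] A) 1 = (Module.finrank S (S ⊗[R] A) : S) :=
    LinearMap.trace_one S _
  have h2 : (1 : Module.End S (S ⊗[R] A)) =
      ∑ i, dualTensorHom S (S ⊗[R] A) (S ⊗[R] A)
        ((G.tr ∘ₗ LinearMap.mulLeft S (G.v i)) ⊗ₜ G.u i) := by
    refine LinearMap.ext fun x => ?_
    simpa [LinearMap.sum_apply] using (G.sum_right x).symm
  have h3 : ∑ i, G.tr (G.v i * G.u i) = 4 := by
    have h := congrArg G.tr (G.casimir 1)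
    simp only [mul_one, map_sum, map_smul, G.tr_one, smul_eq_mul] at h
    simp_rw [G.tr_mul_comm (G.v _)]
    rw [h]
    norm_num
  have h4 : ((Module.finrank S (S ⊗[R] A) : ℕ) : S) = (4 : ℕ) := by
    rw [← h1, h2, map_sum]
    simpa [LinearMap.trace_eq_contract_apply] using h3
  have : CharZero S := algebraRat.charZero S
  exact_mod_cast h4

end TraceFrame

/-- An algebra with a trace frame and an idempotent of trace one is split. -/
theorem TraceFrame.isSplit {ι R A : Type} [Fintype ι] [CommRing R] [Ring A] [Algebra R A]
    (F : TraceFrame ι R A) {e : A} (he : e * e = e) (hte : F.tr e = 1) : IsSplit R A := by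
  -- The algebra acts on the left ideal Ae, a direct summand of A.
  let P : Submodule A A := LinearMap.range (LinearMap.toSpanSingleton A A e)
  have hP : ∀ x : P, (x : A) * e = x := by
    rintro ⟨_, a, rfl⟩
    simp [mul_assoc, he]
  have hmem : ∀ a : A, a * e ∈ P := fun a => ⟨a, rfl⟩
  let π : A →ₗ[R] P := (LinearMap.mulRight R e).codRestrict (P.restrictScalars R) hmem
  have hπ : π ∘ₗ (P.restrictScalars R).subtype = LinearMap.id :=
    LinearMap.ext fun x => Subtype.ext (hP x)
  have hsurj : Function.Surjective π := fun x => ⟨x, LinearMap.congr_fun hπ x⟩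
  have := F.finite
  have := F.projective
  refine ⟨P, inferInstance, inferInstance, Module.Finite.of_surjective π hsurj,
    Module.Projective.of_split _ π hπ, ⟨fun {r s} h => ?_⟩, ⟨AlgEquiv.ofBijective
      (Algebra.lsmul R R P) ⟨?_, fun T => ?_⟩⟩⟩
  · have h1 : r • e = s • e := by
      simpa using congrArg Subtype.val (h ⟨1 * e, hmem 1⟩)
    simpa [hte] using congrArg F.tr h1
  · refine (injective_iff_map_eq_zero _).2 fun b hb => ?_
    -- If b kills Ae, then b = b · tr(e) = ∑ b uᵢ e vᵢ = 0.
    have h1 : ∀ i, b * (F.u i * e) = 0 := fun i => by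
      simpa using congrArg Subtype.val (LinearMap.congr_fun hb ⟨F.u i * e, hmem _⟩)
    have h2 := congrArg (b * ·) (F.casimir e)
    simp only [hte, one_smul, mul_one, Finset.mul_sum, ← mul_assoc] at h2
    simp only [← mul_assoc] at h1
    simpa [h1] using h2.symm
  -- An endomorphism T is left multiplication by ∑ T(uᵢ e) vᵢ, since e(vᵢ x)e = tr(vᵢ x) e for x in
  -- Ae.
  · refine ⟨∑ i, (T (π (F.u i)) : A) * F.v i, LinearMap.ext fun x => Subtype.ext ?_⟩
    have hx : x = π x := (LinearMap.congr_fun hπ x).symm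
    have h1 : ∀ i, (T (π (F.u i)) : A) * F.v i * x = F.tr (F.v i * x) • (T (π (F.u i)) : A) := by
      intro i
      calc (T (π (F.u i)) : A) * F.v i * x = T (π (F.u i)) * (e * (F.v i * x) * e) := by
            simp only [← mul_assoc, hP]
            rw [mul_assoc _ (x : A) e, hP]
        _ = F.tr (F.v i * x) • (T (π (F.u i)) : A) := by
            rw [F.mul_mul_eq he hte, mul_smul_comm, hP, mul_assoc, hP]
    calc ((Algebra.lsmul R R P (∑ i, (T (π (F.u i)) : A) * F.v i)) x : A)
        = (∑ i, (T (π (F.u i)) : A) * F.v i) * x := rfl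
      _ = ((T (π (∑ i, F.tr (F.v i * x) • F.u i)) : P) : A) := by
        rw [Finset.sum_mul]
        simp only [h1, map_sum, map_smul, Submodule.coe_sum]
        rfl
      _ = T x := by rw [F.sum_right, ← hx]

/-! ### The order that extends (-1, f) across the zeros of f. -/

/-- Elements `f`, `b`, `c`, `e` with `f b = c ^ 2 + e ^ 2` and `f`, `e` comaximal in the strong form
`e ^ 2 * δ = 1 + f`, over a ring in which `2` is invertible. -/
structure NormForm (R : Type*) [CommRing R] where
  f : R
  b : R
  c : R
  e : R
  δ : R
  half : R
  mul_eq : f * b = c ^ 2 + e ^ 2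
  comax : e ^ 2 * δ = 1 + f
  two_half : 2 * half = 1

namespace NormForm

variable {R K : Type*} [CommRing R] [CommRing K] [Algebra R K] (N : NormForm R)

/-- The quaternion algebra `(-1, f)` over `K`. -/
abbrev Quat (K : Type*) [CommRing K] [Algebra R K] : Type _ :=
  QuaternionAlgebra K (-1) 0 (algebraMap R K N.f)

/-- The quaternion `p₀ + p₁ i + (t₀ + t₁ i + (t₂ + t₃ i) n) j`, where `n = (c + e i) φ`. -/
def elt (φ : K) (p₀ p₁ t₀ t₁ t₂ t₃ : R) : N.Quat K where
  re := algebraMap R K p₀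
  imI := algebraMap R K p₁
  imJ := algebraMap R K t₀ + algebraMap R K (t₂ * N.c - t₃ * N.e) * φ
  imK := algebraMap R K t₁ + algebraMap R K (t₂ * N.e + t₃ * N.c) * φ

/-- With 𝔞 = R[i] + R[i]n, this expresses 1 as an element of f𝔞𝔞̄, using f(n - n̄) = 2ei and e²δ = 1
+ f. It is what makes the trace form of the order unimodular, including where f vanishes. -/
theorem pairing {φ : K} (hφ : algebraMap R K N.f * φ = 1) : algebraMap R K N.f *
    (2 * (algebraMap R K N.e * algebraMap R K N.δ * algebraMap R K N.half) * φ * algebraMap R K N.e - 1)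
      = 1 := by
  have h1 := congrArg (algebraMap R K) N.comax
  have h2 := congrArg (algebraMap R K) N.two_half
  simp only [map_mul, map_add, map_pow, map_one, map_ofNat] at h1 h2
  linear_combination (2 * (algebraMap R K N.e * algebraMap R K N.δ * algebraMap R K N.half)
    * algebraMap R K N.e) * hφ + algebraMap R K N.e ^ 2 * algebraMap R K N.δ * h2 + h1

/-- The order `R[i] + (R[i] + R[i] n) j` in the quaternion algebra `(-1, f)`, where `φ = f⁻¹` and
`n = (c + e i) φ`. -/
def order (φ : K) (hφ : algebraMap R K N.f * φ = 1) : Subalgebra R (N.Quat K) where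
  carrier := {q | ∃ p₀ p₁ t₀ t₁ t₂ t₃, q = N.elt φ p₀ p₁ t₀ t₁ t₂ t₃}
  mul_mem' := by
    rintro _ _ ⟨p₀, p₁, t₀, t₁, t₂, t₃, rfl⟩ ⟨q₀, q₁, s₀, s₁, s₂, s₃, rfl⟩
    have hb := congrArg (algebraMap R K) N.mul_eq
    -- Coordinates of (p + τj)(q + σj) = pq + fτσ̄ + (pσ + τq̄)j, made integral by fn = c + ei and
    -- fnn̄ = b.
    refine ⟨p₀ * q₀ - p₁ * q₁ + N.f * (t₀ * s₀ + t₁ * s₁)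
        + N.c * (t₂ * s₀ + t₃ * s₁ + t₀ * s₂ + t₁ * s₃)
        + N.e * (t₂ * s₁ - t₃ * s₀ + t₁ * s₂ - t₀ * s₃) + N.b * (t₂ * s₂ + t₃ * s₃),
      p₀ * q₁ + p₁ * q₀ + N.f * (t₁ * s₀ - t₀ * s₁)
        + N.c * (t₃ * s₀ - t₂ * s₁ + t₁ * s₂ - t₀ * s₃)
        + N.e * (t₂ * s₀ + t₃ * s₁ - t₀ * s₂ - t₁ * s₃) + N.b * (t₃ * s₂ - t₂ * s₃),
      p₀ * s₀ - p₁ * s₁ + t₀ * q₀ + t₁ * q₁, p₀ * s₁ + p₁ * s₀ + t₁ * q₀ - t₀ * q₁,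
      p₀ * s₂ - p₁ * s₃ + t₂ * q₀ + t₃ * q₁, p₀ * s₃ + p₁ * s₂ + t₃ * q₀ - t₂ * q₁, ?_⟩
    simp only [map_mul, map_add, map_pow] at hb
    ext <;> simp only [elt, QuaternionAlgebra.re_mul, QuaternionAlgebra.imI_mul,
      QuaternionAlgebra.imJ_mul, QuaternionAlgebra.imK_mul, map_add, map_sub, map_mul]
    · grind
    · grind
    · ring
    · ring
  add_mem' := by
    rintro _ _ ⟨p₀, p₁, t₀, t₁, t₂, t₃, rfl⟩ ⟨q₀, q₁, s₀, s₁, s₂, s₃, rfl⟩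
    refine ⟨p₀ + q₀, p₁ + q₁, t₀ + s₀, t₁ + s₁, t₂ + s₂, t₃ + s₃, ?_⟩
    ext <;> simp [elt] <;> ring
  algebraMap_mem' r := by
    refine ⟨r, 0, 0, 0, 0, 0, ?_⟩
    ext <;> simp [elt, IsScalarTower.algebraMap_apply R K (N.Quat K)]

variable (φ : K) (hφ : algebraMap R K N.f * φ = 1)

theorem elt_mem (p₀ p₁ t₀ t₁ t₂ t₃ : R) : N.elt φ p₀ p₁ t₀ t₁ t₂ t₃ ∈ N.order φ hφ :=
  ⟨p₀, p₁, t₀, t₁, t₂, t₃, rfl⟩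

/-- An element of the order with given coordinates. -/
def ofCoords (p₀ p₁ t₀ t₁ t₂ t₃ : R) : N.order φ hφ := ⟨_, N.elt_mem φ hφ p₀ p₁ t₀ t₁ t₂ t₃⟩

/-- The real part of an element of the order. -/
noncomputable def re (hinj : Function.Injective (algebraMap R K)) : N.order φ hφ →ₗ[R] R :=
  (LinearEquiv.ofInjective (Algebra.linearMap R K) hinj).symm.toLinearMap ∘ₗ
    (((QuaternionAlgebra.reₗ (-1) 0 (algebraMap R K N.f)).restrictScalars R ∘ₗ
      (N.order φ hφ).val.toLinearMap).codRestrict (LinearMap.range (Algebra.linearMap R K)) (by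
        rintro ⟨_, p₀, p₁, t₀, t₁, t₂, t₃, rfl⟩
        exact ⟨p₀, rfl⟩))

theorem algebraMap_re (hinj : Function.Injective (algebraMap R K)) (a : N.order φ hφ) :
    algebraMap R K (N.re φ hφ hinj a) = (a : N.Quat K).re := by
  have h := LinearEquiv.apply_symm_apply (LinearEquiv.ofInjective (Algebra.linearMap R K) hinj)
    (((((QuaternionAlgebra.reₗ (-1) 0 (algebraMap R K N.f)).restrictScalars R ∘ₗ
      (N.order φ hφ).val.toLinearMap).codRestrict (LinearMap.range (Algebra.linearMap R K)) (by
        rintro ⟨_, p₀, p₁, t₀, t₁, t₂, t₃, rfl⟩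
        exact ⟨p₀, rfl⟩))) a)
  exact congrArg Subtype.val h

/-- The trace frame of the order. -/
noncomputable def frame (hinj : Function.Injective (algebraMap R K)) :
    TraceFrame (Fin 6) R (N.order φ hφ) where
  tr := N.re φ hφ hinj + N.re φ hφ hinj
  u := ![N.ofCoords φ hφ 1 0 0 0 0 0, N.ofCoords φ hφ 0 1 0 0 0 0, N.ofCoords φ hφ 0 0 1 0 0 0,
    N.ofCoords φ hφ 0 0 0 1 0 0, N.ofCoords φ hφ 0 0 0 0 1 0, N.ofCoords φ hφ 0 0 0 0 0 1]
  v := ![N.ofCoords φ hφ N.half 0 0 0 0 0, N.ofCoords φ hφ 0 (-N.half) 0 0 0 0,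
    N.ofCoords φ hφ 0 0 (-N.half) 0 0 (-N.half * (N.e * N.δ * N.half)),
    N.ofCoords φ hφ 0 0 0 (-N.half) (N.half * (N.e * N.δ * N.half)) 0,
    N.ofCoords φ hφ 0 0 0 (N.half * (N.e * N.δ * N.half)) 0 0,
    N.ofCoords φ hφ 0 0 (-N.half * (N.e * N.δ * N.half)) 0 0 0]
  tr_one := by
    have h : N.re φ hφ hinj 1 = 1 := hinj (by rw [algebraMap_re]; simp)
    rw [LinearMap.add_apply, h, one_add_one_eq_two]
  sum_left a := by
    have hS := N.pairing hφ
    have h2 := congrArg (algebraMap R K) N.two_half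
    simp only [map_mul, map_one, map_ofNat] at h2
    apply Subtype.ext
    ext <;> simp [Fin.sum_univ_six, ofCoords, elt] <;>
      simp only [Algebra.smul_def, map_add, algebraMap_re, Subalgebra.coe_mul] <;> simp
    · linear_combination (a : N.Quat K).re * h2
    · linear_combination (a : N.Quat K).imI * h2
    · linear_combination (a : N.Quat K).imJ * h2 +
        2 * algebraMap R K N.half * (a : N.Quat K).imJ * hS
    · linear_combination (a : N.Quat K).imK * h2 +
        2 * algebraMap R K N.half * (a : N.Quat K).imK * hS
  sum_right a := by
    have hS := N.pairing hφ
    have h2 := congrArg (algebraMap R K) N.two_half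
    simp only [map_mul, map_one, map_ofNat] at h2
    apply Subtype.ext
    ext <;> simp [Fin.sum_univ_six, ofCoords, elt] <;>
      simp only [Algebra.smul_def, map_add, algebraMap_re, Subalgebra.coe_mul] <;> simp
    · linear_combination (a : N.Quat K).re * h2
    · linear_combination (a : N.Quat K).imI * h2
    · linear_combination (a : N.Quat K).imJ * h2 +
        2 * algebraMap R K N.half * (a : N.Quat K).imJ * hS
    · linear_combination (a : N.Quat K).imK * h2 +
        2 * algebraMap R K N.half * (a : N.Quat K).imK * hS
  casimir a := by
    have hS := N.pairing hφ
    have h2 := congrArg (algebraMap R K) N.two_half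
    simp only [map_mul, map_one, map_ofNat] at h2
    apply Subtype.ext
    ext <;> simp [Fin.sum_univ_six, ofCoords, elt]
    · simp only [Algebra.smul_def, map_add, algebraMap_re]
      linear_combination 2 * (a : N.Quat K).re * h2 +
        2 * algebraMap R K N.half * (a : N.Quat K).re * hS
    · linear_combination -2 * algebraMap R K N.half * (a : N.Quat K).imI * hS
    · ring
  conj_mul a b := by
    apply Subtype.ext
    ext <;> simp <;>
      simp only [Algebra.smul_def, map_add, algebraMap_re, Subalgebra.coe_mul] <;> simp <;> ring

end NormForm

/-! ### Splitting criteria and the Brauer class in terms of I and J. -/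

/-- Elements `I`, `J` with `I ^ 2 = -1`, `J ^ 2 = f`, `J I = - I J`, of trace zero, which generate the
algebra up to multiplication by `f`. -/
structure TraceFrame.IsGenerating {ι R A : Type*} [Fintype ι] [CommRing R] [Ring A] [Algebra R A]
    (F : TraceFrame ι R A) (f : R) (I J : A) : Prop where
  I_mul_I : I * I = -1
  J_mul_J : J * J = f • (1 : A)
  J_mul_I : J * I = -(I * J)
  tr_I : F.tr I = 0
  tr_J : F.tr J = 0
  tr_IJ : F.tr (I * J) = 0
  span : ∀ a, ∃ p₀ p₁ p₂ p₃ : R, f • a = p₀ • (1 : A) + p₁ • I + p₂ • J + p₃ • (I * J)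

theorem NormForm.smul_elt {R K : Type*} [CommRing R] [CommRing K] [Algebra R K]
    (N : NormForm R) (φ : K) (hφ : algebraMap R K N.f * φ = 1) (p₀ p₁ t₀ t₁ t₂ t₃ : R) :
    N.f • N.elt φ p₀ p₁ t₀ t₁ t₂ t₃ = (N.f * p₀) • (1 : N.Quat K) +
      (N.f * p₁) • N.elt φ 0 1 0 0 0 0 +
      (N.f * t₀ + t₂ * N.c - t₃ * N.e) • N.elt φ 0 0 1 0 0 0 +
      (N.f * t₁ + t₂ * N.e + t₃ * N.c) • (N.elt φ 0 1 0 0 0 0 * N.elt φ 0 0 1 0 0 0) := by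
  have h1 : N.elt φ 0 1 0 0 0 0 = ⟨0, 1, 0, 0⟩ := by ext <;> simp [elt]
  have h2 : N.elt φ 0 0 1 0 0 0 = ⟨0, 0, 1, 0⟩ := by ext <;> simp [elt]
  have h3 : (⟨0, 1, 0, 0⟩ : N.Quat K) * ⟨0, 0, 1, 0⟩ = ⟨0, 0, 0, 1⟩ := by ext <;> simp
  rw [h1, h2, h3]
  ext <;> simp only [elt, QuaternionAlgebra.re_smul, QuaternionAlgebra.re_add,
    QuaternionAlgebra.re_one, QuaternionAlgebra.imI_smul, QuaternionAlgebra.imI_add,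
    QuaternionAlgebra.imI_one, QuaternionAlgebra.imJ_smul, QuaternionAlgebra.imJ_add,
    QuaternionAlgebra.imJ_one, QuaternionAlgebra.imK_smul, QuaternionAlgebra.imK_add,
    QuaternionAlgebra.imK_one] <;>
    simp only [Algebra.smul_def, map_add, map_sub, map_mul]
  · ring
  · ring
  · linear_combination (algebraMap R K t₂ * algebraMap R K N.c
        - algebraMap R K t₃ * algebraMap R K N.e) * hφ
  · linear_combination (algebraMap R K t₂ * algebraMap R K N.e
        + algebraMap R K t₃ * algebraMap R K N.c) * hφ

theorem NormForm.isGenerating {R K : Type*} [CommRing R] [CommRing K] [Algebra R K]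
    (N : NormForm R) (φ : K) (hφ : algebraMap R K N.f * φ = 1)
    (hinj : Function.Injective (algebraMap R K)) :
    (N.frame φ hφ hinj).IsGenerating N.f (N.ofCoords φ hφ 0 1 0 0 0 0)
      (N.ofCoords φ hφ 0 0 1 0 0 0) where
  I_mul_I := by
    apply Subtype.ext
    ext <;> simp [ofCoords, elt]
  J_mul_J := by
    apply Subtype.ext
    ext <;> simp [ofCoords, elt, Algebra.algebraMap_eq_smul_one]
  J_mul_I := by
    apply Subtype.ext
    ext <;> simp [ofCoords, elt]
  tr_I := by
    apply hinj
    simp [frame, algebraMap_re, ofCoords, elt]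
  tr_J := by
    apply hinj
    simp [frame, algebraMap_re, ofCoords, elt]
  tr_IJ := by
    apply hinj
    simp [frame, algebraMap_re, ofCoords, elt]
  span := by
    rintro ⟨_, p₀, p₁, t₀, t₁, t₂, t₃, rfl⟩
    exact ⟨_, _, _, _, Subtype.ext (N.smul_elt φ hφ p₀ p₁ t₀ t₁ t₂ t₃)⟩

namespace TraceFrame

/-- A trace-zero involution splits the algebra. -/
theorem isSplit_of_involution {ι R A : Type} [Fintype ι] [CommRing R] [Ring A] [Algebra R A]
    (F : TraceFrame ι R A) {h : R} (h2 : 2 * h = 1) {w : A} (hw : w * w = 1) (htw : F.tr w = 0) :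
    IsSplit R A := by
  refine F.isSplit (e := h • (1 + w)) ?_ ?_
  · have : (1 + w) * (1 + w) = (2 : R) • (1 + w) := by
      rw [two_smul, mul_add, mul_one, add_mul, hw, one_mul]
      abel
    rw [smul_mul_smul_comm, this, smul_smul]
    congr 1
    linear_combination h * h2
  · rw [map_smul, map_add, F.tr_one, htw, smul_eq_mul]
    linear_combination h2

namespace IsGenerating

variable {ι R A : Type*} [Fintype ι] [CommRing R] [Ring A] [Algebra R A]
  {F : TraceFrame ι R A} {f : R} {I J : A}

theorem baseChange (G : F.IsGenerating f I J) (S : Type*) [CommRing S] [Algebra R S] :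
    (F.baseChange S).IsGenerating (algebraMap R S f) (1 ⊗ₜ I) (1 ⊗ₜ J) where
  I_mul_I := by simp [G.I_mul_I, TensorProduct.tmul_neg, Algebra.TensorProduct.one_def]
  J_mul_J := by simp [G.J_mul_J, Algebra.TensorProduct.one_def]
  J_mul_I := by simp [G.J_mul_I, TensorProduct.tmul_neg]
  tr_I := by simp [G.tr_I]
  tr_J := by simp [G.tr_J]
  tr_IJ := by simp [G.tr_IJ]
  span a := by
    induction a using TensorProduct.induction_on with
    | zero => exact ⟨0, 0, 0, 0, by simp⟩
    | add s t hs ht =>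
      obtain ⟨p₀, p₁, p₂, p₃, hp⟩ := hs
      obtain ⟨q₀, q₁, q₂, q₃, hq⟩ := ht
      refine ⟨p₀ + q₀, p₁ + q₁, p₂ + q₂, p₃ + q₃, ?_⟩
      rw [smul_add, hp, hq]
      module
    | tmul s a =>
      obtain ⟨p₀, p₁, p₂, p₃, hp⟩ := G.span a
      refine ⟨p₀ • s, p₁ • s, p₂ • s, p₃ • s, ?_⟩
      rw [algebraMap_smul, ← TensorProduct.tmul_smul, hp, Algebra.TensorProduct.tmul_mul_tmul,
        mul_one, Algebra.TensorProduct.one_def]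
      simp only [smul_smul_one_tmul, TensorProduct.tmul_add]

/-- J acts on R[I] by conjugation, so the square is f times the norm of p + qI. -/
theorem mul_mul_mul (G : F.IsGenerating f I J) (p q : R) :
    ((p • (1 : A) + q • I) * J) * ((p • (1 : A) + q • I) * J) = (f * (p ^ 2 + q ^ 2)) • (1 : A) := by
  have h : J * (p • (1 : A) + q • I) = (p • (1 : A) - q • I) * J := by
    simp [mul_add, add_mul, G.J_mul_I, sub_eq_add_neg]
  have h' : (p • (1 : A) + q • I) * (p • (1 : A) - q • I) = (p ^ 2 + q ^ 2) • (1 : A) := by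
    simp only [mul_sub, add_mul, smul_mul_smul_comm, mul_one, one_mul, G.I_mul_I]
    module
  rw [mul_assoc, ← mul_assoc J, h, mul_assoc _ J, G.J_mul_J, ← mul_assoc, h', mul_smul_comm,
    mul_one, smul_smul]

theorem isSplit_of_sq {ι R A : Type} [Fintype ι] [CommRing R] [Ring A] [Algebra R A]
    {F : TraceFrame ι R A} {f : R} {I J : A} (G : F.IsGenerating f I J) {h : R} (h2 : 2 * h = 1)
    {s : R} (hs : s * s = -1) : IsSplit R A := by
  refine F.isSplit_of_involution h2 (w := s • I) ?_ ?_
  · rw [smul_mul_smul_comm, G.I_mul_I, hs, neg_smul, smul_neg, neg_neg, one_smul]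
  · rw [map_smul, G.tr_I, smul_zero]

theorem isSplit_of_norm {ι R A : Type} [Fintype ι] [CommRing R] [Ring A] [Algebra R A]
    {F : TraceFrame ι R A} {f : R} {I J : A} (G : F.IsGenerating f I J) {h : R} (h2 : 2 * h = 1)
    {φ p q : R} (hφ : f * φ = 1) (hf : f = p ^ 2 + q ^ 2) : IsSplit R A := by
  refine F.isSplit_of_involution h2 (w := φ • ((p • (1 : A) + q • I) * J)) ?_ ?_
  · rw [smul_mul_smul_comm, G.mul_mul_mul, ← hf, smul_smul]
    have : φ * φ * (f * f) = 1 := by linear_combination (f * φ + 1) * hφ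
    rw [this, one_smul]
  · simp [add_mul, G.tr_J, G.tr_IJ]

/-- A quaternion algebra with anisotropic norm form is not split. -/
theorem not_isSplit {ι K A : Type} [Fintype ι] [Field K] [Ring A] [Algebra K A]
    {F : TraceFrame ι K A} {f : K} {I J : A} (G : F.IsGenerating f I J) (h2 : (2 : K) ≠ 0)
    (hf : f ≠ 0)
    (haniso : ∀ a b c d : K, a ^ 2 + b ^ 2 = f * (c ^ 2 + d ^ 2) → a = 0 ∧ b = 0 ∧ c = 0 ∧ d = 0) :
    ¬ IsSplit K A := by
  rintro ⟨V, _, _, _, _, _, ⟨Φ⟩⟩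
  have hnt : (1 : A) ≠ 0 := fun h => h2 (by rw [← F.tr_one, h, map_zero])
  -- Conjugate times x is the norm form up to a unit factor, so by anisotropy a nonzero x has a left
  -- inverse and the only idempotents are 0 and 1.
  have hidem : ∀ x : A, x * x = x → x = 0 ∨ x = 1 := by
    intro x hx
    obtain ⟨a, b, c, d, h⟩ := G.span x
    have hx' : x = f⁻¹ • (a • (1 : A) + b • I + c • J + d • (I * J)) := by
      rw [← h, smul_smul, inv_mul_cancel₀ hf, one_smul]
    have hn : (a • (1 : A) - b • I - c • J - d • (I * J)) *
        (a • (1 : A) + b • I + c • J + d • (I * J)) =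
        (a ^ 2 + b ^ 2 - f * (c ^ 2 + d ^ 2)) • (1 : A) := by
      have e1 : I * (I * J) = -J := by rw [← mul_assoc, G.I_mul_I, neg_one_mul]
      have e2 : (I * J) * I = J := by rw [mul_assoc, G.J_mul_I, mul_neg, e1, neg_neg]
      have e3 : (I * J) * J = f • I := by rw [mul_assoc, G.J_mul_J, mul_smul_comm, mul_one]
      have e4 : J * (I * J) = -(f • I) := by rw [← mul_assoc, G.J_mul_I, neg_mul, e3]
      have e5 : (I * J) * (I * J) = f • (1 : A) := by
        rw [← mul_assoc, e2, G.J_mul_J]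
      simp only [mul_add, sub_mul, smul_mul_smul_comm, mul_one, one_mul, G.I_mul_I, G.J_mul_J,
        G.J_mul_I, e1, e2, e3, e4, e5]
      module
    by_cases h0 : a ^ 2 + b ^ 2 - f * (c ^ 2 + d ^ 2) = 0
    · obtain ⟨rfl, rfl, rfl, rfl⟩ := haniso a b c d (sub_eq_zero.1 h0)
      left
      simp [hx']
    · right
      have h3 : (a • (1 : A) - b • I - c • J - d • (I * J)) * x =
          (f⁻¹ * (a ^ 2 + b ^ 2 - f * (c ^ 2 + d ^ 2))) • (1 : A) := by
        rw [hx', mul_smul_comm, hn, smul_smul]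
      have h4 := congrArg ((a • (1 : A) - b • I - c • J - d • (I * J)) * ·) hx
      simp only [← mul_assoc] at h4
      rw [h3, smul_mul_assoc, one_mul] at h4
      exact smul_right_injective A (mul_ne_zero (inv_ne_zero hf) h0) h4
  have hidem' : ∀ T : Module.End K V, T * T = T → T = 0 ∨ T = 1 := by
    intro T hT
    have := hidem (Φ.symm T) (by rw [← map_mul, hT])
    simpa using this
  have hV : Nontrivial V := by
    by_contra hV
    rw [not_nontrivial_iff_subsingleton] at hV
    exact hnt (Φ.injective (Subsingleton.elim _ _))
  obtain ⟨v, hv⟩ := exists_ne (0 : V)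
  obtain ⟨θ, hθ⟩ := Module.Projective.exists_dual_eq_one K hv
  -- The projection onto the line of v is a nonzero idempotent, hence the identity. So V is a line
  -- and End V is commutative, against JI = -IJ.
  have hproj : ∀ y : V, θ y • v = y := by
    rcases hidem' (θ.smulRight v) (LinearMap.ext fun y => by simp [hθ]) with h | h
    · exact absurd (by simpa [hθ] using LinearMap.congr_fun h v) hv
    · exact fun y => LinearMap.congr_fun h y
  have hcomm : ∀ S T : Module.End K V, S * T = T * S := by
    have hs : ∀ (T : Module.End K V) y, T y = θ (T v) • y := fun T y => by
      conv_lhs => rw [← hproj y, map_smul, ← hproj (T v)]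
      rw [smul_comm, hproj]
    intro S T
    refine LinearMap.ext fun y => ?_
    rw [Module.End.mul_apply, Module.End.mul_apply, hs T y, hs S y, map_smul, map_smul,
      hs S y, hs T y, smul_comm]
  have hIJ : J * I = I * J := Φ.injective (by rw [map_mul, map_mul, hcomm])
  have h5 : (2 : K) • (I * J) = 0 := by
    rw [two_smul]
    nth_rewrite 1 [← hIJ]
    rw [G.J_mul_I, neg_add_cancel]
  have h6 : I * J = 0 := (smul_eq_zero.1 h5).resolve_left h2
  have h7 : I * (I * J) * J = -(f • (1 : A)) := by
    rw [← mul_assoc, G.I_mul_I, mul_assoc, G.J_mul_J, neg_one_mul]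
  rw [h6, mul_zero, zero_mul, eq_comm, neg_eq_zero, smul_eq_zero] at h7
  exact h7.elim hf hnt

/-- If `f g = p ^ 2 + q ^ 2`, the algebra `(f, -1)` is also `(g, -d ^ 2)`. -/
theorem brauerEquivalent {ι K A : Type} [Fintype ι] [CommRing K] [Ring A] [Algebra K A]
    {F : TraceFrame ι K A} {f : K} {I J : A} (G : F.IsGenerating f I J) (h2 : IsUnit (2 : K))
    {g d m p q : K} (hf : IsUnit f) (hg : IsUnit g) (hd : IsUnit d) (hm : m = -d ^ 2)
    (hfg : f * g = p ^ 2 + q ^ 2) :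
    BrauerEquivalent K A (QuaternionAlgebra K g 0 m) := by
  obtain ⟨φ, hφ⟩ := hf.exists_right_inv
  have e1 : I * (I * J) = -J := by rw [← mul_assoc, G.I_mul_I, neg_one_mul]
  have e2 : I * J * I = J := by rw [mul_assoc, G.J_mul_I, mul_neg, e1, neg_neg]
  -- The new generators are f⁻¹(p + qI)J, with square f⁻²·f·fg = g, and dI, with square -d² = m.
  let β : QuaternionAlgebra.Basis A g 0 m :=
    { i := φ • ((p • (1 : A) + q • I) * J)
      j := d • I
      k := (φ • ((p • (1 : A) + q • I) * J)) * (d • I)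
      i_mul_i := by
        rw [smul_mul_smul_comm, G.mul_mul_mul, ← hfg, smul_smul, zero_smul, add_zero]
        congr 1
        linear_combination g * (f * φ + 1) * hφ
      j_mul_j := by
        rw [smul_mul_smul_comm, G.I_mul_I, hm]
        module
      i_mul_j := rfl
      j_mul_i := by
        simp only [add_mul, mul_add, smul_add, smul_mul_assoc, mul_smul_comm, one_mul, e1, e2,
          G.J_mul_I]
        module }
  have htr : ∀ a b c e : K, F.tr (a • (1 : A) + b • β.i + c • β.j + e • β.k) = 2 * a := by
    intro a b c e
    simp [β, add_mul, G.tr_I, G.tr_J, G.tr_IJ, F.tr_one, G.J_mul_I, e2, mul_comm]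
  have hlift : ∀ x : QuaternionAlgebra K g 0 m,
      F.tr (QuaternionAlgebra.lift β x) = 2 * x.re := by
    intro x
    rw [← htr x.re x.imI x.imJ x.imK, ← Algebra.algebraMap_eq_smul_one]
    rfl
  have hmu : IsUnit m := by
    rw [hm]
    exact (hd.pow 2).neg
  -- The kernel is orthogonal to everything under the trace form of the source, which is
  -- nondegenerate since 2, g and m are units.
  have hinj : Function.Injective (QuaternionAlgebra.lift β) := by
    refine (injective_iff_map_eq_zero _).2 fun x hx => ?_
    have h : ∀ y, (x * y).re = 0 := fun y => by
      have := hlift (x * y)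
      rw [map_mul, hx, zero_mul, map_zero] at this
      exact (h2.mul_right_eq_zero).1 this.symm
    have h0 := h ⟨1, 0, 0, 0⟩
    have h1 := h ⟨0, 1, 0, 0⟩
    have h2 := h ⟨0, 0, 1, 0⟩
    have h3 := h ⟨0, 0, 0, 1⟩
    simp only [QuaternionAlgebra.re_mul, mul_one, mul_zero, add_zero, sub_zero, zero_add,
      zero_sub, zero_mul, neg_eq_zero, hg.mul_right_eq_zero, hmu.mul_right_eq_zero,
      (hg.mul hmu).mul_right_eq_zero] at h0 h1 h2 h3
    ext <;> assumption
  have hsurj : Function.Surjective (QuaternionAlgebra.lift β) := by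
    rw [← AlgHom.range_eq_top, eq_top_iff]
    have hi : β.i ∈ (QuaternionAlgebra.lift β).range := ⟨⟨0, 1, 0, 0⟩, by
      change β.lift _ = _
      simp [QuaternionAlgebra.Basis.lift]⟩
    have hj : d • I ∈ (QuaternionAlgebra.lift β).range := ⟨⟨0, 0, 1, 0⟩, by
      change β.lift _ = β.j
      simp [QuaternionAlgebra.Basis.lift]⟩
    obtain ⟨d', hd'⟩ := hd.exists_right_inv
    obtain ⟨g', hg'⟩ := hg.exists_right_inv
    have hI : I ∈ (QuaternionAlgebra.lift β).range := by
      have := Subalgebra.smul_mem _ hj d'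
      rwa [smul_smul, mul_comm, hd', one_smul] at this
    have hJ : J ∈ (QuaternionAlgebra.lift β).range := by
      have h1 : (p • (1 : A) - q • I) * β.i = g • J := by
        simp only [β, mul_smul_comm, sub_mul, add_mul, mul_add, smul_mul_assoc, one_mul, e1]
        have : g = φ * (p ^ 2 + q ^ 2) := by linear_combination (-g) * hφ + φ * hfg
        rw [this]
        module
      have h3 := Subalgebra.smul_mem _ (mul_mem (sub_mem
        (Subalgebra.smul_mem _ (one_mem _) p) (Subalgebra.smul_mem _ hI q)) hi) g'
      rwa [h1, smul_smul, mul_comm, hg', one_smul] at h3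
    intro a _
    obtain ⟨p₀, p₁, p₂, p₃, h⟩ := G.span a
    have h4 : a = φ • (p₀ • (1 : A) + p₁ • I + p₂ • J + p₃ • (I * J)) := by
      rw [← h, smul_smul, mul_comm, hφ, one_smul]
    rw [h4]
    exact Subalgebra.smul_mem _ (add_mem (add_mem (add_mem (Subalgebra.smul_mem _ (one_mem _) _)
      (Subalgebra.smul_mem _ hI _)) (Subalgebra.smul_mem _ hJ _))
      (Subalgebra.smul_mem _ (mul_mem hI hJ) _)) _
  have hK : Module.Finite K K ∧ Module.Projective K K ∧ FaithfulSMul K K :=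
    ⟨inferInstance, inferInstance, inferInstance⟩
  exact ⟨K, inferInstance, inferInstance, K, inferInstance, inferInstance, hK, hK,
    ⟨Algebra.TensorProduct.congr (AlgEquiv.ofBijective _ ⟨hinj, hsurj⟩).symm AlgEquiv.refl⟩⟩

end IsGenerating

end TraceFrame

/-! ### The Azumaya algebra on the surface. -/

namespace MarkoffK3

theorem coord_eqn (k : ℤ) : coord k 0 ^ 2 + coord k 1 ^ 2 + coord k 2 ^ 2
    - 4 * coord k 0 ^ 2 * coord k 1 ^ 2 * coord k 2 ^ 2 = (k : CoordRing k) := by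
  have h : Ideal.Quotient.mk (Ideal.span {surfacePoly k}) (surfacePoly k) = 0 :=
    Ideal.Quotient.eq_zero_iff_mem.2 (Ideal.mem_span_singleton_self _)
  have hC : (MvPolynomial.C (k : ℚ) : MvPolynomial (Fin 3) ℚ) = ((k : ℤ) : MvPolynomial (Fin 3) ℚ) :=
    map_intCast _ _
  rw [surfacePoly, hC] at h
  simp only [map_sub, map_add, map_mul, map_pow, map_ofNat, map_intCast] at h
  exact sub_eq_zero.1 h

theorem Point.evalHom_coord {k : ℤ} {K : Type} [CommRing K] [Algebra ℚ K] (P : Point k K) (i : Fin 3) :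
    P.evalHom (coord k i) = ![P.x, P.y, P.z] i := by
  change MvPolynomial.aeval ![P.x, P.y, P.z] (MvPolynomial.X i) = _
  rw [MvPolynomial.aeval_X]

theorem dvd_of_dvd_prime_mul {R : Type*} [CommRing R] [IsDomain R] {p P q : R} (hp : Prime p)
    (hP : ¬ p ∣ P) (h : P ∣ p * q) : P ∣ q := by
  obtain ⟨r, hr⟩ := h
  obtain ⟨s, rfl⟩ := (hp.dvd_or_dvd ⟨q, hr.symm⟩).resolve_left hP
  exact ⟨s, mul_left_cancel₀ hp.ne_zero (by rw [hr]; ring)⟩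

/-- The polynomial is linear in the j-th variable, with coprime coefficients. -/
theorem prime_two_mul_X_mul_X_add {i j : Fin 3} (hij : i ≠ j) {s : ℚ} (hs : s ≠ 0) :
    Prime (MvPolynomial.C 2 * MvPolynomial.X i * MvPolynomial.X j + MvPolynomial.C s :
      MvPolynomial (Fin 3) ℚ) := by
  refine (MvPolynomial.irreducible_mul_X_add _ _ j ?_ ?_ ?_ ?_).prime
  · exact mul_ne_zero (by simp) (MvPolynomial.X_ne_zero i)
  · intro h
    have := MvPolynomial.vars_mul _ _ h
    simp only [MvPolynomial.vars_C, MvPolynomial.vars_X, Finset.empty_union,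
      Finset.mem_singleton] at this
    exact hij this.symm
  · simp
  · exact ((isUnit_iff_ne_zero.2 hs).map MvPolynomial.C).isRelPrime_right

theorem not_dvd_surfacePoly {k : ℤ} {i j : Fin 3} {s : ℚ} (v : Fin 3 → ℚ)
    (hv : 2 * v i * v j + s = 0)
    (hk : v 0 ^ 2 + v 1 ^ 2 + v 2 ^ 2 - 4 * v 0 ^ 2 * v 1 ^ 2 * v 2 ^ 2 ≠ k) :
    ¬ MvPolynomial.C 2 * MvPolynomial.X i * MvPolynomial.X j + MvPolynomial.C s ∣
      surfacePoly k := by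
  rintro ⟨q, hq⟩
  have h := congrArg (MvPolynomial.eval v) hq
  rw [map_mul] at h
  simp only [surfacePoly, map_add, map_sub, map_mul, map_pow, map_ofNat, MvPolynomial.eval_X,
    MvPolynomial.eval_C] at h
  rw [hv, zero_mul, sub_eq_zero] at h
  exact hk h

/-- The factors 2xy ± 1 are prime in the polynomial ring and do not divide the surface polynomial,
as the test points v show; each can thus be cancelled modulo it. Irreducibility of the surface is
not needed. -/
theorem coord_mul_mem_nonZeroDivisors {k : ℤ} {i j : Fin 3} (hij : i ≠ j) (v : ℚ → Fin 3 → ℚ)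
    (hv : ∀ s : ℚ, 2 * v s i * v s j + s = 0)
    (hk : ∀ s, v s 0 ^ 2 + v s 1 ^ 2 + v s 2 ^ 2 - 4 * v s 0 ^ 2 * v s 1 ^ 2 * v s 2 ^ 2 ≠ k) :
    4 * coord k i ^ 2 * coord k j ^ 2 - 1 ∈ nonZeroDivisors (CoordRing k) := by
  refine mem_nonZeroDivisors_iff_right.2 fun q hq => ?_
  obtain ⟨q, rfl⟩ := Ideal.Quotient.mk_surjective q
  have h1 : (q * (4 * MvPolynomial.X i ^ 2 * MvPolynomial.X j ^ 2 - 1) : MvPolynomial (Fin 3) ℚ) ∈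
      Ideal.span {surfacePoly k} := by
    rw [← Ideal.Quotient.eq_zero_iff_mem, ← hq]
    simp only [map_mul, map_sub, map_pow, map_ofNat, map_one]
    rfl
  rw [Ideal.mem_span_singleton] at h1
  have h2 : (q * (4 * MvPolynomial.X i ^ 2 * MvPolynomial.X j ^ 2 - 1) : MvPolynomial (Fin 3) ℚ) =
      (MvPolynomial.C 2 * MvPolynomial.X i * MvPolynomial.X j + MvPolynomial.C 1) *
      ((MvPolynomial.C 2 * MvPolynomial.X i * MvPolynomial.X j + MvPolynomial.C (-1)) * q) := by
    simp only [map_ofNat, map_neg, map_one]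
    ring
  rw [h2] at h1
  rw [Ideal.Quotient.eq_zero_iff_mem, Ideal.mem_span_singleton]
  exact dvd_of_dvd_prime_mul (prime_two_mul_X_mul_X_add hij (by norm_num))
    (not_dvd_surfacePoly (v (-1)) (hv _) (hk _))
    (dvd_of_dvd_prime_mul (prime_two_mul_X_mul_X_add hij one_ne_zero)
    (not_dvd_surfacePoly (v 1) (hv _) (hk _)) h1)

theorem isUnit_algebraMap_funField {k : ℤ} {r : CoordRing k} (h : r ∈ nonZeroDivisors (CoordRing k)) :
    IsUnit (algebraMap (CoordRing k) (FunField k) r) :=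
  IsLocalization.map_units (FunField k) ⟨r, h⟩

theorem isUnit_xy {k : ℤ} (hk : k < 0) :
    IsUnit (algebraMap (CoordRing k) (FunField k) (4 * coord k 0 ^ 2 * coord k 1 ^ 2 - 1)) := by
  have hk' : (k : ℚ) < 0 := by exact_mod_cast hk
  refine isUnit_algebraMap_funField (coord_mul_mem_nonZeroDivisors (by decide)
    (fun s => ![1, -s / 2, 0]) (fun s => ?_) (fun s => ?_))
  · simp; ring
  · simp; nlinarith [sq_nonneg (s / 2)]

theorem isUnit_yz {k : ℤ} (hk : k < 0) :
    IsUnit (algebraMap (CoordRing k) (FunField k) (4 * coord k 1 ^ 2 * coord k 2 ^ 2 - 1)) := by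
  have hk' : (k : ℚ) < 0 := by exact_mod_cast hk
  refine isUnit_algebraMap_funField (coord_mul_mem_nonZeroDivisors (by decide)
    (fun s => ![0, 1, -s / 2]) (fun s => ?_) (fun s => ?_))
  · simp; ring
  · simp; nlinarith [sq_nonneg (s / 2)]

theorem isUnit_zx {k : ℤ} (hk : k < 0) :
    IsUnit (algebraMap (CoordRing k) (FunField k) (4 * coord k 2 ^ 2 * coord k 0 ^ 2 - 1)) := by
  have hk' : (k : ℚ) < 0 := by exact_mod_cast hk
  refine isUnit_algebraMap_funField (coord_mul_mem_nonZeroDivisors (by decide)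
    (fun s => ![-s / 2, 0, 1]) (fun s => ?_) (fun s => ?_))
  · simp; ring
  · simp; nlinarith [sq_nonneg (s / 2)]

theorem intCast_eq_of_eq {S : Type*} [CommRing S] {k ℓ : ℤ} (hk : k = -(1 + 16 * ℓ ^ 2)) :
    (k : S) = -(1 + 16 * (ℓ : S) ^ 2) := by
  rw [hk]
  push_cast
  ring

/-- The norm form data with `f = 4 x ^ 2 y ^ 2 - 1` on the surface with `k = -(1 + 16 ℓ ^ 2)`. -/
noncomputable def surfaceNormForm {k ℓ : ℤ} (hk : k = -(1 + 16 * ℓ ^ 2)) (hℓ : ℓ ≠ 0) :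
    NormForm (CoordRing k) where
  f := 4 * coord k 0 ^ 2 * coord k 1 ^ 2 - 1
  -- The extra factor y² makes e² = 64ℓ²x²y² = 16ℓ²(1 + f), so e is invertible wherever f vanishes.
  b := coord k 1 ^ 2 * (4 * coord k 0 ^ 2 * coord k 2 ^ 2 - 1)
  c := coord k 1 * (2 * coord k 0 ^ 2 + 1)
  e := 8 * ℓ * coord k 0 * coord k 1
  δ := algebraMap ℚ _ (1 / (16 * ℓ ^ 2))
  half := algebraMap ℚ _ (1 / 2)
  mul_eq := by
    have h := coord_eqn k
    rw [intCast_eq_of_eq hk] at h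
    linear_combination (-4 * coord k 0 ^ 2 * coord k 1 ^ 2) * h
  comax := by
    have h : (16 * (ℓ : CoordRing k) ^ 2) * algebraMap ℚ (CoordRing k) (1 / (16 * ℓ ^ 2)) = 1 := by
      have : (16 * (ℓ : CoordRing k) ^ 2) = algebraMap ℚ (CoordRing k) (16 * ℓ ^ 2) := by
        rw [map_mul, map_pow, map_ofNat, map_intCast]
      rw [this, ← map_mul, mul_one_div_cancel, map_one]
      have : (ℓ : ℚ) ≠ 0 := by exact_mod_cast hℓ
      positivity
    linear_combination (4 * coord k 0 ^ 2 * coord k 1 ^ 2) * h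
  two_half := by
    rw [← map_ofNat (algebraMap ℚ (CoordRing k)), ← map_mul]
    norm_num

/-- There is a quaternion Azumaya algebra on the surface that is generically `(4x²y² - 1, -1)`. -/
theorem exists_azumaya {k ℓ : ℤ} (hk : k = -(1 + 16 * ℓ ^ 2)) (hℓ : ℓ ≠ 0) :
    ∃ (𝒜 : QuaternionAzumaya (CoordRing k)) (F : TraceFrame (Fin 6) (CoordRing k) 𝒜.carrier)
      (I J : 𝒜.carrier), F.IsGenerating (4 * coord k 0 ^ 2 * coord k 1 ^ 2 - 1) I J := by
  have hk0 : k < 0 := by rw [hk]; nlinarith [sq_nonneg ℓ]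
  obtain ⟨φ, hφ⟩ := (isUnit_xy hk0).exists_right_inv
  let N := surfaceNormForm hk hℓ
  have hinj : Function.Injective (algebraMap (CoordRing k) (FunField k)) :=
    IsFractionRing.injective _ _
  let F := N.frame φ hφ hinj
  have h2 : IsUnit (2 : CoordRing k) := IsUnit.of_mul_eq_one _ N.two_half
  exact ⟨{ carrier := N.order φ hφ
           isAzumaya := F.isAzumaya h2
           rank_eq_four := F.rankAtStalk_eq_four }, F, _, _, N.isGenerating φ hφ hinj⟩

section

variable {k : ℤ} {𝒜 : QuaternionAzumaya (CoordRing k)}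
  {F : TraceFrame (Fin 6) (CoordRing k) 𝒜.carrier} {I J : 𝒜.carrier}

theorem two_mul_algebraMap_half (S : Type*) [CommRing S] [Algebra ℚ S] :
    2 * algebraMap ℚ S (1 / 2) = 1 := by
  rw [← map_ofNat (algebraMap ℚ S), ← map_mul]
  norm_num

theorem isAlgebraicClass_of_isGenerating
    (G : F.IsGenerating (4 * coord k 0 ^ 2 * coord k 1 ^ 2 - 1) I J) : IsAlgebraicClass 𝒜 := by
  obtain ⟨i, hi⟩ := IsAlgClosed.exists_eq_mul_self (-1 : AlgebraicClosure ℚ)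
  refine (G.baseChange (CoordRing k ⊗[ℚ] AlgebraicClosure ℚ)).isSplit_of_sq
    (two_mul_algebraMap_half _) (s := 1 ⊗ₜ i) ?_
  rw [Algebra.TensorProduct.tmul_mul_tmul, ← hi, TensorProduct.tmul_neg, mul_one,
    Algebra.TensorProduct.one_def]

theorem hasGenericClass_of_isGenerating {ℓ : ℤ} (hk : k = -(1 + 16 * ℓ ^ 2)) (hℓ : ℓ ≠ 0)
    (G : F.IsGenerating (4 * coord k 0 ^ 2 * coord k 1 ^ 2 - 1) I J) {g p q : CoordRing k}
    (hg : IsUnit (algebraMap (CoordRing k) (FunField k) g))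
    (hfg : (4 * coord k 0 ^ 2 * coord k 1 ^ 2 - 1) * g = p ^ 2 + q ^ 2) :
    HasGenericClass 𝒜 g ((k : CoordRing k) + 1) := by
  have hk0 : k < 0 := by rw [hk]; nlinarith [sq_nonneg ℓ]
  have h2 : IsUnit (2 : CoordRing k) := IsUnit.of_mul_eq_one _ (two_mul_algebraMap_half _)
  have hd : IsUnit (4 * (ℓ : CoordRing k)) := by
    have h : IsUnit (4 * (ℓ : ℚ)) := by
      have : (ℓ : ℚ) ≠ 0 := by exact_mod_cast hℓ
      exact isUnit_iff_ne_zero.2 (by positivity)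
    have h' := h.map (algebraMap ℚ (CoordRing k))
    rwa [map_mul, map_ofNat, map_intCast] at h'
  refine (G.baseChange (FunField k)).brauerEquivalent
    (d := algebraMap _ _ (4 * (ℓ : CoordRing k))) (p := algebraMap _ _ p) (q := algebraMap _ _ q)
    ?_ (isUnit_xy hk0) hg (hd.map _) ?_ ?_
  · have h' := h2.map (algebraMap (CoordRing k) (FunField k))
    rwa [map_ofNat] at h'
  -- k + 1 = -(4ℓ)².
  · rw [← map_pow, ← map_neg]
    congr 1
    rw [intCast_eq_of_eq hk]
    ring
  · rw [← map_mul, hfg, map_add, map_pow, map_pow]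

theorem hasGenericClass_xy {ℓ : ℤ} (hk : k = -(1 + 16 * ℓ ^ 2)) (hℓ : ℓ ≠ 0)
    (G : F.IsGenerating (4 * coord k 0 ^ 2 * coord k 1 ^ 2 - 1) I J) :
    HasGenericClass 𝒜 (4 * coord k 0 ^ 2 * coord k 1 ^ 2 - 1) ((k : CoordRing k) + 1) :=
  hasGenericClass_of_isGenerating hk hℓ G (isUnit_xy (by rw [hk]; nlinarith [sq_nonneg ℓ]))
    (p := 4 * coord k 0 ^ 2 * coord k 1 ^ 2 - 1) (q := 0) (by ring)

theorem coord_eqn_of_eq {ℓ : ℤ} (hk : k = -(1 + 16 * ℓ ^ 2)) :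
    coord k 0 ^ 2 + coord k 1 ^ 2 + coord k 2 ^ 2
      - 4 * coord k 0 ^ 2 * coord k 1 ^ 2 * coord k 2 ^ 2 = -(1 + 16 * (ℓ : CoordRing k) ^ 2) := by
  rw [coord_eqn, intCast_eq_of_eq hk]

theorem hasGenericClass_yz {ℓ : ℤ} (hk : k = -(1 + 16 * ℓ ^ 2)) (hℓ : ℓ ≠ 0)
    (G : F.IsGenerating (4 * coord k 0 ^ 2 * coord k 1 ^ 2 - 1) I J) :
    HasGenericClass 𝒜 (4 * coord k 1 ^ 2 * coord k 2 ^ 2 - 1) ((k : CoordRing k) + 1) :=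
  hasGenericClass_of_isGenerating hk hℓ G (isUnit_yz (by rw [hk]; nlinarith [sq_nonneg ℓ]))
    (p := 2 * coord k 1 ^ 2 + 1) (q := 8 * ℓ * coord k 1) (by
      linear_combination (-4 * coord k 1 ^ 2) * coord_eqn_of_eq hk)

theorem hasGenericClass_zx {ℓ : ℤ} (hk : k = -(1 + 16 * ℓ ^ 2)) (hℓ : ℓ ≠ 0)
    (G : F.IsGenerating (4 * coord k 0 ^ 2 * coord k 1 ^ 2 - 1) I J) :
    HasGenericClass 𝒜 (4 * coord k 2 ^ 2 * coord k 0 ^ 2 - 1) ((k : CoordRing k) + 1) :=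
  hasGenericClass_of_isGenerating hk hℓ G (isUnit_zx (by rw [hk]; nlinarith [sq_nonneg ℓ]))
    (p := 2 * coord k 0 ^ 2 + 1) (q := 8 * ℓ * coord k 0) (by
      linear_combination (-4 * coord k 0 ^ 2) * coord_eqn_of_eq hk)

variable {K : Type} [Field K] [Algebra ℚ K]

theorem isSplitAt_of_sq (G : F.IsGenerating (4 * coord k 0 ^ 2 * coord k 1 ^ 2 - 1) I J)
    (P : Point k K) {s : K} (hs : s * s = -1) : IsSplitAt 𝒜 P := by
  let _ : Algebra (CoordRing k) K := P.evalHom.toRingHom.toAlgebra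
  exact (G.baseChange K).isSplit_of_sq (two_mul_algebraMap_half K) hs

theorem Point.evalHom_xy (P : Point k K) :
    P.evalHom (4 * coord k 0 ^ 2 * coord k 1 ^ 2 - 1) = 4 * P.x ^ 2 * P.y ^ 2 - 1 := by
  simp only [map_sub, map_mul, map_pow, map_ofNat, map_one, P.evalHom_coord]
  rfl

theorem isSplitAt_of_norm (G : F.IsGenerating (4 * coord k 0 ^ 2 * coord k 1 ^ 2 - 1) I J)
    (P : Point k K) (h0 : 4 * P.x ^ 2 * P.y ^ 2 - 1 ≠ 0) {p q : K}
    (h : 4 * P.x ^ 2 * P.y ^ 2 - 1 = p ^ 2 + q ^ 2) : IsSplitAt 𝒜 P := by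
  let _ : Algebra (CoordRing k) K := P.evalHom.toRingHom.toAlgebra
  have e : algebraMap (CoordRing k) K (4 * coord k 0 ^ 2 * coord k 1 ^ 2 - 1) =
    4 * P.x ^ 2 * P.y ^ 2 - 1 := P.evalHom_xy
  refine (G.baseChange K).isSplit_of_norm (two_mul_algebraMap_half K) (e ▸ mul_inv_cancel₀ h0)
    (e.trans h)

theorem not_isSplitAt (G : F.IsGenerating (4 * coord k 0 ^ 2 * coord k 1 ^ 2 - 1) I J)
    (P : Point k K) (h0 : 4 * P.x ^ 2 * P.y ^ 2 - 1 ≠ 0)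
    (h : ∀ a b c d : K, a ^ 2 + b ^ 2 = (4 * P.x ^ 2 * P.y ^ 2 - 1) * (c ^ 2 + d ^ 2) →
      a = 0 ∧ b = 0 ∧ c = 0 ∧ d = 0) : ¬ IsSplitAt 𝒜 P := by
  let _ : Algebra (CoordRing k) K := P.evalHom.toRingHom.toAlgebra
  have e : algebraMap (CoordRing k) K (4 * coord k 0 ^ 2 * coord k 1 ^ 2 - 1) =
    4 * P.x ^ 2 * P.y ^ 2 - 1 := P.evalHom_xy
  have : CharZero K := algebraRat.charZero K
  refine (G.baseChange K).not_isSplit two_ne_zero (e ▸ h0) (e ▸ h)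

end

end MarkoffK3

/-! ### Squares, sums of two squares and norm forms over the p-adic integers. -/

namespace PadicInt

variable {p : ℕ} [Fact p.Prime]

theorem exists_sq_eq_of_norm_lt {a t : ℤ_[p]} (h : ‖a ^ 2 - t‖ < ‖2 * a‖ ^ 2) :
    ∃ z : ℤ_[p], z ^ 2 = t := by
  obtain ⟨z, hz, -⟩ := hensels_lemma (p := p) (F := (Polynomial.X ^ 2 - Polynomial.C t)) (a := a)
    (by simpa [Polynomial.derivative_X_pow, one_add_one_eq_two] using h)
  exact ⟨z, by simpa [sub_eq_zero] using hz⟩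

theorem norm_eq_one_iff_toZMod_ne_zero {x : ℤ_[p]} : ‖x‖ = 1 ↔ toZMod x ≠ 0 := by
  rw [← isUnit_iff, ← not_iff_not, not_not, ← RingHom.mem_ker, ker_toZMod,
    IsLocalRing.mem_maximalIdeal, mem_nonunits_iff]

theorem norm_lt_one_iff_toZMod_eq_zero {x : ℤ_[p]} : ‖x‖ < 1 ↔ toZMod x = 0 := by
  rw [lt_iff_le_and_ne, ← not_iff_not (b := toZMod x = 0), ← ne_eq (toZMod x),
    ← norm_eq_one_iff_toZMod_ne_zero]
  simp [norm_le_one]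

theorem toZMod_surjective : Function.Surjective (toZMod (p := p)) := fun x =>
  ⟨(x.val : ℤ_[p]), by rw [map_natCast, ZMod.natCast_zmod_val]⟩

theorem norm_two (hp : p ≠ 2) : ‖(2 : ℤ_[p])‖ = 1 := by
  rw [norm_eq_one_iff_toZMod_ne_zero, map_ofNat]
  intro h
  have h2 : ((2 : ℕ) : ZMod p) = 0 := by exact_mod_cast h
  rw [ZMod.natCast_eq_zero_iff, Nat.prime_dvd_prime_iff_eq Fact.out Nat.prime_two] at h2
  exact hp h2

/-- A unit that is a nonzero square modulo an odd prime `p` is a square. -/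
theorem exists_sq_eq_of_toZMod (hp : p ≠ 2) {t : ℤ_[p]} {α : ZMod p} (hα : α ≠ 0)
    (h : toZMod t = α ^ 2) : ∃ z : ℤ_[p], z ^ 2 = t := by
  obtain ⟨a, rfl⟩ := toZMod_surjective α
  refine exists_sq_eq_of_norm_lt (a := a) ?_
  rw [norm_mul, norm_two hp, norm_eq_one_iff_toZMod_ne_zero.2 hα, mul_one, one_pow,
    norm_lt_one_iff_toZMod_eq_zero, map_sub, map_pow, h, sub_self]

theorem exists_mul_self_eq_neg_one (hp : p % 4 = 1) : ∃ s : ℤ_[p], s * s = -1 := by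
  obtain ⟨α, hα⟩ := ZMod.exists_sq_eq_neg_one_iff.2 (show p % 4 ≠ 3 by omega)
  obtain ⟨s, hs⟩ := exists_sq_eq_of_toZMod (t := -1) (by rintro rfl; omega)
    (α := α) (by rintro rfl; simp at hα) (by rw [map_neg, map_one, hα, sq])
  exact ⟨s, by rw [← sq, hs]⟩

/-- A unit of `ℤ_[p]` is a sum of two squares for odd `p`. -/
theorem exists_sq_add_sq (hp : p ≠ 2) {t : ℤ_[p]} (ht : toZMod t ≠ 0) :
    ∃ a b : ℤ_[p], t = a ^ 2 + b ^ 2 := by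
  obtain ⟨α, β, h⟩ := ZMod.sq_add_sq p (toZMod t)
  -- One residue is nonzero. The other is lifted arbitrarily, and Hensel's lemma lifts the nonzero
  -- one.
  wlog hα : α ≠ 0 generalizing α β
  · refine this β α (by rw [add_comm, h]) ?_
    rintro rfl
    rw [not_not] at hα
    exact ht (by rw [← h, hα]; ring)
  obtain ⟨b, rfl⟩ := toZMod_surjective β
  obtain ⟨a, ha⟩ := exists_sq_eq_of_toZMod hp hα (t := t - b ^ 2) (by
    rw [map_sub, map_pow, ← h]; ring)
  exact ⟨a, b, by rw [ha]; ring⟩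

end PadicInt

/-- In ZMod 8, 4a = 0 says that a is even. Modulo 4 would not suffice: four odd entries are excluded
only because 2 ≠ 3·2 and 2 ≠ 7·2 modulo 8. -/
theorem ZMod.four_mul_eq_zero_of_sq_add_sq {a b c d w : ZMod 8}
    (h : a ^ 2 + b ^ 2 = (4 * w - 1) * (c ^ 2 + d ^ 2)) :
    4 * a = 0 ∧ 4 * b = 0 ∧ 4 * c = 0 ∧ 4 * d = 0 := by
  have hw : ∀ w : ZMod 8, 4 * w - 1 = 3 ∨ 4 * w - 1 = 7 := by decide
  have hsq : ∀ a : ZMod 8, a ^ 2 = 1 ∨ 4 * a = 0 ∧ (a ^ 2 = 0 ∨ a ^ 2 = 4) := by decide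
  rcases hw w with hw | hw <;> rw [hw] at h <;>
  rcases hsq a with ha | ⟨ha', ha | ha⟩ <;> rcases hsq b with hb | ⟨hb', hb | hb⟩ <;>
  rcases hsq c with hc | ⟨hc', hc | hc⟩ <;> rcases hsq d with hd | ⟨hd', hd | hd⟩ <;>
  rw [ha, hb, hc, hd] at h <;>
  first
  | exact absurd h (by decide)
  | exact ⟨ha', hb', hc', hd'⟩

/-- The norm form of the quaternion algebra `(-1, 4 w - 1)` is anisotropic over `ℚ_[2]`. -/
theorem Padic.two_anisotropic (w : ℤ_[2]) {a b c d : ℚ_[2]}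
    (h : a ^ 2 + b ^ 2 = (4 * (w : ℚ_[2]) - 1) * (c ^ 2 + d ^ 2)) :
    a = 0 ∧ b = 0 ∧ c = 0 ∧ d = 0 := by
  -- Dividing by the coordinate of largest norm gives a 2-adically integral solution with a
  -- coordinate equal to 1, which is not even.
  let v : Fin 4 → ℚ_[2] := ![a, b, c, d]
  obtain ⟨m, hm⟩ := Finite.exists_max fun i => ‖v i‖
  by_cases h0 : v m = 0
  · have : ∀ i, v i = 0 := fun i => by simpa [h0] using hm i
    exact ⟨this 0, this 1, this 2, this 3⟩
  · exfalso
    have hle : ∀ i, ‖v i / v m‖ ≤ 1 := fun i => by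
      rw [norm_div]
      exact div_le_one_of_le₀ (hm i) (norm_nonneg _)
    let u : Fin 4 → ℤ_[2] := fun i => ⟨v i / v m, hle i⟩
    have hu : u 0 ^ 2 + u 1 ^ 2 = (4 * w - 1) * (u 2 ^ 2 + u 3 ^ 2) := by
      apply PadicInt.ext
      have e : (a / v m) ^ 2 + (b / v m) ^ 2 =
          (4 * (w : ℚ_[2]) - 1) * ((c / v m) ^ 2 + (d / v m) ^ 2) := by
        field_simp
        exact h
      push_cast
      exact e
    have h8 := congrArg (PadicInt.toZModPow (p := 2) 3) hu
    simp only [map_add, map_mul, map_sub, map_pow, map_ofNat, map_one] at h8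
    obtain ⟨e0, e1, e2, e3⟩ := ZMod.four_mul_eq_zero_of_sq_add_sq h8
    have hall : ∀ i, 4 * (PadicInt.toZModPow (p := 2) 3 (u i)) = 0 := by
      intro i
      fin_cases i
      exacts [e0, e1, e2, e3]
    have h1 : u m = 1 := PadicInt.ext (div_self h0)
    have h2 := hall m
    rw [h1, map_one] at h2
    exact absurd h2 (by decide)

theorem Nat.exists_prime_mod_four_eq_three {n : ℕ} (hn : n % 4 = 3) :
    ∃ p : ℕ, p.Prime ∧ p ∣ n ∧ p % 4 = 3 := by
  induction n using Nat.strong_induction_on with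
  | _ n ih =>
    obtain ⟨p, hp, m, rfl⟩ := Nat.exists_prime_and_dvd (show n ≠ 1 by omega)
    by_cases h3 : p % 4 = 3
    · exact ⟨p, hp, Dvd.intro _ rfl, h3⟩
    · have hm : m % 4 = 3 := by
        rw [Nat.mul_mod] at hn
        have h1 : p % 4 < 4 := Nat.mod_lt _ (by norm_num)
        have h2 : m % 4 < 4 := Nat.mod_lt _ (by norm_num)
        interval_cases p % 4 <;> interval_cases m % 4 <;> simp_all
      obtain ⟨q, hq, hqm, h⟩ := ih m (by nlinarith [hp.two_le, Nat.pos_of_ne_zero (show m ≠ 0 by omega)]) hm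
      exact ⟨q, hq, hqm.mul_left p, h⟩

/-! ### Local points, local invariants and the obstruction. -/

namespace MarkoffK3

theorem zmod_four_mul_ne_zero {p : ℕ} [Fact p.Prime] (h3 : p % 4 = 3) {ℓ : ℤ}
    (hprime : ∀ p : ℕ, p.Prime → (p : ℤ) ∣ ℓ → p ≡ 1 [MOD 4]) : 4 * (ℓ : ZMod p) ≠ 0 := by
  have hℓ : (ℓ : ZMod p) ≠ 0 := by
    rw [Ne, ZMod.intCast_zmod_eq_zero_iff_dvd]
    intro h
    have := hprime p Fact.out h
    rw [Nat.ModEq] at this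
    omega
  refine mul_ne_zero (fun h => ?_) hℓ
  have h4 : ((4 : ℕ) : ZMod p) = 0 := by exact_mod_cast h
  rw [ZMod.natCast_eq_zero_iff] at h4
  have := Nat.le_of_dvd (by norm_num) h4
  have hp3 : p = 3 := by omega
  subst hp3
  omega

/-- At a prime `p ≡ 3 mod 4`, the function `4 x² y² - 1` does not vanish modulo `p`. -/
theorem Point.xy_ne_zero {p : ℕ} [Fact p.Prime] (h3 : p % 4 = 3) {k ℓ : ℤ}
    (hk : k = -(1 + 16 * ℓ ^ 2)) (hprime : ∀ p : ℕ, p.Prime → (p : ℤ) ∣ ℓ → p ≡ 1 [MOD 4])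
    (P : Point k (ZMod p)) : 4 * P.x ^ 2 * P.y ^ 2 - 1 ≠ 0 := by
  intro h
  have hℓ := zmod_four_mul_ne_zero h3 hprime
  have he := P.eqn
  rw [intCast_eq_of_eq hk] at he
  have hf : (2 * P.x * P.y - 1) * (2 * P.x * P.y + 1) = 0 := by linear_combination h
  rcases mul_eq_zero.1 hf with h1 | h1
  -- With 4x²y² = 1 the terms in z cancel, and 2xy = 1 gives (x + y)² = k + 1 = -(4ℓ)².
  · exact ZMod.mod_four_ne_three_of_sq_eq_neg_sq' hℓ (x := P.x + P.y)
      (by linear_combination he + P.z ^ 2 * h + h1) h3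
  · exact ZMod.mod_four_ne_three_of_sq_eq_neg_sq' hℓ (x := P.x - P.y)
      (by linear_combination he + P.z ^ 2 * h - h1) h3

end MarkoffK3

namespace MarkoffK3

theorem nonempty_adelicPoint {k ℓ : ℤ} (hk : k = -(1 + 16 * ℓ ^ 2)) : Nonempty (AdelicPoint k) := by
  have h30 : (3 : ZMod 2) ≠ 0 := by decide
  have hR : Nonempty (Point k ℝ) := by
    have h : (0 : ℝ) ≤ (2 - k) / 3 := by
      have e : (2 - (k : ℝ)) / 3 = (3 + 16 * (ℓ : ℝ) ^ 2) / 3 := by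
        rw [intCast_eq_of_eq hk]
        ring
      rw [e]
      positivity
    exact ⟨⟨1, 1, √((2 - k) / 3), by rw [Real.sq_sqrt h]; ring⟩⟩
  have hp : ∀ p : Nat.Primes, Nonempty (Point k ℤ_[(p : ℕ)]) := by
    rintro ⟨p, hp⟩
    have : Fact p.Prime := ⟨hp⟩
    change Nonempty (Point k ℤ_[p])
    by_cases h2 : p = 2
    · subst h2
      have h3 : IsUnit (3 : ℤ_[2]) := by
        rw [PadicInt.isUnit_iff, PadicInt.norm_eq_one_iff_toZMod_ne_zero, map_ofNat]
        exact h30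
      obtain ⟨t, ht⟩ := h3.exists_right_inv
      -- At x = y = 1 the equation is 3z² = 2 - k = 3 + 16ℓ², so z² ≡ 1 mod 16.
      obtain ⟨z, hz⟩ := PadicInt.exists_sq_eq_of_norm_lt (a := (1 : ℤ_[2])) (t := (2 - k) * t) (by
        have e : (1 : ℤ_[2]) ^ 2 - (2 - k) * t = 2 ^ 4 * (-(ℓ : ℤ_[2]) ^ 2 * t) := by
          rw [intCast_eq_of_eq hk]
          linear_combination -ht
        have h2 : ‖(2 : ℤ_[2])‖ = 2⁻¹ := by simpa using PadicInt.norm_p (p := 2)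
        rw [e, norm_mul, norm_pow, mul_one, h2]
        have := PadicInt.norm_le_one (-(ℓ : ℤ_[2]) ^ 2 * t)
        nlinarith)
      exact ⟨⟨1, 1, z, by rw [hz]; linear_combination (k - 2 : ℤ_[2]) * ht⟩⟩
    · by_cases h1 : p % 4 = 1
      · obtain ⟨s, hs⟩ := PadicInt.exists_mul_self_eq_neg_one h1
        have hu : IsUnit (2 : ℤ_[p]) := PadicInt.isUnit_iff.2 (PadicInt.norm_two h2)
        obtain ⟨t, ht⟩ := hu.exists_right_inv
        -- k = ((k + 1)/2)² - ((k - 1)/2)², with the minus sign absorbed by s² = -1.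
        refine ⟨⟨(k + 1) * t, (k - 1) * t * s, 0, ?_⟩⟩
        linear_combination ((k - 1) * t) ^ 2 * hs + (k * (2 * t + 1)) * ht
      · have h3 : p % 4 = 3 := by
          have := hp.eq_two_or_odd
          omega
        -- k is a unit, since p dividing 1 + (4ℓ)² would make -1 a square modulo p.
        obtain ⟨a, b, hab⟩ := PadicInt.exists_sq_add_sq h2 (t := (k : ℤ_[p])) (by
          rw [map_intCast, intCast_eq_of_eq hk]
          intro h
          exact ZMod.mod_four_ne_three_of_sq_eq_neg_sq' (p := p) (x := 4 * (ℓ : ZMod p)) one_ne_zero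
            (by linear_combination -h) h3)
        exact ⟨⟨a, b, 0, by rw [hab]; ring⟩⟩
  exact ⟨⟨hR.some, fun p => (hp p).some⟩⟩

theorem isEmpty_point_int {k ℓ : ℤ} (hk : k = -(1 + 16 * ℓ ^ 2))
    (hprime : ∀ p : ℕ, p.Prime → (p : ℤ) ∣ ℓ → p ≡ 1 [MOD 4]) : IsEmpty (Point k ℤ) := by
  refine ⟨fun P => ?_⟩
  have he := P.eqn
  rw [Int.cast_id] at he
  have hpos : 0 < 4 * P.x ^ 2 * P.y ^ 2 - 1 := by
    by_contra h
    have h1 : (4 * P.x ^ 2 * P.y ^ 2 - 1) * P.z ^ 2 ≤ 0 :=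
      mul_nonpos_of_nonpos_of_nonneg (not_lt.1 h) (sq_nonneg _)
    nlinarith [sq_nonneg P.x, sq_nonneg P.y, sq_nonneg ℓ]
  obtain ⟨n, hn⟩ := Int.eq_ofNat_of_zero_le hpos.le
  have h4 : n % 4 = 3 := by
    have : (n : ℤ) = 4 * (P.x ^ 2 * P.y ^ 2) - 1 := by rw [← hn]; ring
    omega
  obtain ⟨p, hp, hpn, h3⟩ := Nat.exists_prime_mod_four_eq_three h4
  have : Fact p.Prime := ⟨hp⟩
  apply (P.map (Int.castRingHom (ZMod p))).xy_ne_zero h3 hk hprime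
  have h0 : ((4 * P.x ^ 2 * P.y ^ 2 - 1 : ℤ) : ZMod p) = 0 := by
    rw [hn, ZMod.intCast_zmod_eq_zero_iff_dvd]
    exact_mod_cast hpn
  simpa [Point.map] using h0

section

variable {k ℓ : ℤ} {𝒜 : QuaternionAzumaya (CoordRing k)}
  {F : TraceFrame (Fin 6) (CoordRing k) 𝒜.carrier} {I J : 𝒜.carrier}

theorem localInv_of_isSplitAt {K : Type} [Field K] [Algebra ℚ K] {P : Point k K}
    (h : IsSplitAt 𝒜 P) : localInv 𝒜 P = 0 := if_pos h

theorem localInv_of_not_isSplitAt {K : Type} [Field K] [Algebra ℚ K] {P : Point k K}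
    (h : ¬ IsSplitAt 𝒜 P) : localInv 𝒜 P = ((1 / 2 : ℚ) : QmodZ) := if_neg h

theorem invInfty_eq_zero (hk : k = -(1 + 16 * ℓ ^ 2))
    (G : F.IsGenerating (4 * coord k 0 ^ 2 * coord k 1 ^ 2 - 1) I J) (P : Point k ℝ) :
    invInfty 𝒜 P = 0 := by
  have he := P.eqn
  rw [intCast_eq_of_eq hk] at he
  have hpos : 0 < 4 * P.x ^ 2 * P.y ^ 2 - 1 := by
    by_contra h
    have h1 : (4 * P.x ^ 2 * P.y ^ 2 - 1) * P.z ^ 2 ≤ 0 :=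
      mul_nonpos_of_nonpos_of_nonneg (not_lt.1 h) (sq_nonneg _)
    nlinarith [sq_nonneg P.x, sq_nonneg P.y, sq_nonneg (ℓ : ℝ)]
  exact localInv_of_isSplitAt (isSplitAt_of_norm G P hpos.ne' (p := √(4 * P.x ^ 2 * P.y ^ 2 - 1))
    (q := 0) (by rw [Real.sq_sqrt hpos.le]; ring))

theorem toZMod_xy_ne_zero {p : ℕ} [Fact p.Prime] (h3 : p % 4 = 3)
    (hk : k = -(1 + 16 * ℓ ^ 2)) (hprime : ∀ p : ℕ, p.Prime → (p : ℤ) ∣ ℓ → p ≡ 1 [MOD 4])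
    (P : Point k ℤ_[p]) : PadicInt.toZMod (4 * P.x ^ 2 * P.y ^ 2 - 1) ≠ 0 := by
  have h := (P.map (PadicInt.toZMod (p := p))).xy_ne_zero h3 hk hprime
  rw [map_sub, map_mul, map_mul, map_pow, map_pow, map_ofNat, map_one]
  exact h

theorem isSplitAt_padic {p : ℕ} [Fact p.Prime] (h2 : p ≠ 2)
    (hk : k = -(1 + 16 * ℓ ^ 2)) (hprime : ∀ p : ℕ, p.Prime → (p : ℤ) ∣ ℓ → p ≡ 1 [MOD 4])
    (G : F.IsGenerating (4 * coord k 0 ^ 2 * coord k 1 ^ 2 - 1) I J) (P : Point k ℤ_[p]) :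
    IsSplitAt 𝒜 (P.map (PadicInt.Coe.ringHom (p := p))) := by
  by_cases h1 : p % 4 = 1
  · obtain ⟨s, hs⟩ := PadicInt.exists_mul_self_eq_neg_one h1
    exact isSplitAt_of_sq G _ (s := (s : ℚ_[p])) (by rw [← PadicInt.coe_mul, hs]; simp)
  · have h3 : p % 4 = 3 := by
      have := (Fact.out : p.Prime).eq_two_or_odd
      omega
    have hne := toZMod_xy_ne_zero h3 hk hprime P
    obtain ⟨a, b, hab⟩ := PadicInt.exists_sq_add_sq h2 hne
    have e : PadicInt.Coe.ringHom (p := p) (4 * P.x ^ 2 * P.y ^ 2 - 1) =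
        4 * (P.map (PadicInt.Coe.ringHom (p := p))).x ^ 2 *
          (P.map (PadicInt.Coe.ringHom (p := p))).y ^ 2 - 1 := by
      simp only [map_sub, map_mul, map_pow, map_ofNat, map_one]
      rfl
    refine isSplitAt_of_norm G _ (p := a) (q := b) ?_ ?_
    · rw [← e]
      intro h
      apply hne
      have h0 : 4 * P.x ^ 2 * P.y ^ 2 - 1 = 0 := PadicInt.ext h
      rw [h0, map_zero]
    · rw [← e, hab, map_add, map_pow, map_pow]
      rfl

theorem not_isSplitAt_two (G : F.IsGenerating (4 * coord k 0 ^ 2 * coord k 1 ^ 2 - 1) I J)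
    (P : Point k ℤ_[2]) : ¬ IsSplitAt 𝒜 (P.map (PadicInt.Coe.ringHom (p := 2))) := by
  have e : 4 * (P.map (PadicInt.Coe.ringHom (p := 2))).x ^ 2 *
      (P.map (PadicInt.Coe.ringHom (p := 2))).y ^ 2 - 1 =
      4 * ((P.x ^ 2 * P.y ^ 2 : ℤ_[2]) : ℚ_[2]) - 1 := by
    push_cast
    rw [← mul_assoc]
    rfl
  have haniso : ∀ a b c d : ℚ_[2], a ^ 2 + b ^ 2 =
      (4 * ((P.x ^ 2 * P.y ^ 2 : ℤ_[2]) : ℚ_[2]) - 1) * (c ^ 2 + d ^ 2) →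
      a = 0 ∧ b = 0 ∧ c = 0 ∧ d = 0 := fun a b c d => Padic.two_anisotropic _
  refine not_isSplitAt G _ ?_ (by rw [e]; exact haniso)
  rw [e]
  intro h
  exact one_ne_zero (haniso 0 0 1 0 (by rw [h]; ring)).2.2.1

theorem invAt_eq (hk : k = -(1 + 16 * ℓ ^ 2))
    (hprime : ∀ p : ℕ, p.Prime → (p : ℤ) ∣ ℓ → p ≡ 1 [MOD 4])
    (G : F.IsGenerating (4 * coord k 0 ^ 2 * coord k 1 ^ 2 - 1) I J) (p : Nat.Primes)
    (P : Point k ℤ_[(p : ℕ)]) :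
    invAt 𝒜 p P = if (p : ℕ) = 2 then ((1 / 2 : ℚ) : QmodZ) else 0 := by
  split_ifs with h2
  · obtain rfl : p = ⟨2, Nat.prime_two⟩ := Subtype.ext h2
    exact localInv_of_not_isSplitAt (not_isSplitAt_two G P)
  · exact localInv_of_isSplitAt (isSplitAt_padic (p := (p : ℕ)) h2 hk hprime G P)

theorem QmodZ.half_ne_zero : ((1 / 2 : ℚ) : QmodZ) ≠ 0 := by
  rw [Ne, AddCircle.coe_eq_zero_iff]
  rintro ⟨n, hn⟩
  rw [zsmul_one] at hn
  have h : (2 * n : ℤ) = 1 := by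
    have : (2 : ℚ) * n = 1 := by rw [hn]; norm_num
    exact_mod_cast this
  omega

theorem brauerManinSet_eq_empty (hinf : ∀ P : Point k ℝ, invInfty 𝒜 P = 0)
    (hfin : ∀ (p : Nat.Primes) (P : Point k ℤ_[(p : ℕ)]),
      invAt 𝒜 p P = if (p : ℕ) = 2 then ((1 / 2 : ℚ) : QmodZ) else 0) :
    brauerManinSet 𝒜 = ∅ := by
  refine Set.eq_empty_of_forall_notMem fun P hP => QmodZ.half_ne_zero ?_
  have h : invInfty 𝒜 P.1 + ∑ᶠ p : Nat.Primes, invAt 𝒜 p (P.2 p) = 0 := hP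
  simp_rw [hinf, hfin] at h
  -- Only the term at 2 is nonzero, so the `finsum` is a genuine sum and not its default value 0.
  have hsum := finsum_eq_single
    (fun p : Nat.Primes => if (p : ℕ) = 2 then ((1 / 2 : ℚ) : QmodZ) else 0)
    ⟨2, Nat.prime_two⟩ fun p hp => if_neg fun h2 => hp (Subtype.ext h2)
  rw [zero_add, hsum, if_pos rfl] at h
  exact h

end

end MarkoffK3

theorem mainTheorem2 (ℓ k : ℤ) (hk : k = -(1 + 16 * ℓ ^ 2)) (hodd : Odd ℓ)
    (h5 : ¬ ℓ ≡ 2 [ZMOD 5]) (h5' : ¬ ℓ ≡ -2 [ZMOD 5])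
    (hprime : ∀ p : ℕ, p.Prime → (p : ℤ) ∣ ℓ → p ≡ 1 [MOD 4]) :
    Nonempty (AdelicPoint k) ∧
    ∃ 𝒜 : QuaternionAzumaya (CoordRing k),
      IsAlgebraicClass 𝒜 ∧
      HasGenericClass 𝒜 (4 * coord k 0 ^ 2 * coord k 1 ^ 2 - 1) ((k : CoordRing k) + 1) ∧
      HasGenericClass 𝒜 (4 * coord k 1 ^ 2 * coord k 2 ^ 2 - 1) ((k : CoordRing k) + 1) ∧
      HasGenericClass 𝒜 (4 * coord k 2 ^ 2 * coord k 0 ^ 2 - 1) ((k : CoordRing k) + 1) ∧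
      (∀ P : Point k ℝ, invInfty 𝒜 P = 0) ∧
      (∀ (p : Nat.Primes) (P : Point k ℤ_[(p : ℕ)]),
        invAt 𝒜 p P = if (p : ℕ) = 2 then ((1 / 2 : ℚ) : QmodZ) else 0) ∧
      Set.range (diagonal (k := k)) ⊆ brauerManinSet 𝒜 ∧
      brauerManinSet 𝒜 = ∅ := by

  have hℓ : ℓ ≠ 0 := by
    rintro rfl
    exact absurd hodd (by decide)
  obtain ⟨𝒜, F, I, J, G⟩ := exists_azumaya hk hℓ
  have hempty : brauerManinSet 𝒜 = ∅ :=
    brauerManinSet_eq_empty (invInfty_eq_zero hk G) (invAt_eq hk hprime G)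
  have := isEmpty_point_int hk hprime
  exact ⟨nonempty_adelicPoint hk, 𝒜, isAlgebraicClass_of_isGenerating G,
    hasGenericClass_xy hk hℓ G, hasGenericClass_yz hk hℓ G, hasGenericClass_zx hk hℓ G,
    invInfty_eq_zero hk G, invAt_eq hk hprime G, by
      -- The inclusion holds because there are no integral points at all.
      rw [Set.range_eq_empty]
      exact Set.empty_subset _, hempty⟩
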